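/- Let $p$ be a prime, $r$ a natural number, $\mathbb{Z}_{p^r}$ the integers modulo $p^r$; for $0\le s\le r$ and $a\in\mathbb{Z}_{p^r}$ let $[a]_s\in\{0,\dots,p^s-1\}$ be the residue of $a$ modulo $p^s$. For a random variable $Z$ on a finite alphabet $\mathcal{Z}$ and $\epsilon>0$, let $A^{(n)}_\epsilon(Z)$ be the set of sequences $\mathbf z\in\mathcal{Z}^n$ such that $|\frac1n N(a|\mathbf z)-P(Z=a)|\le \epsilon/|\mathcal{Z}|$ for all $a\in\mathcal{Z}$, and $N(a|\mathbf z)=0$ whenever $P(Z=a)=0$, where $N(a|\mathbf z)$ is the number of occurrences of $a$ in $\mathbf z$. Entropies are in bits. Fix $m\ge 1$, random variables $U_1,\dots,U_m$ on $\mathbb{Z}_{p^r}$, a random variable $Q$ on $\{1,\dots,m\}$ with $P(Q=i)>0$ for all $i$, and $\rho>0$; let $U$ satisfy $P(U=a\mid Q=i)=P(U_i=a)$. For each $n$ let $k_1(n),\dots,k_m(n)$ be natural numbers and $l(n)$ a positive integer such that, as $n\to\infty$, $\frac{k_i(n)}{n}\to \rho\,P(Q=i)$ for every $i$, and $\frac1n\log_2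 l(n)\to R_{bin}$. Put $R=\rho\,H(U|Q)$. Choose $k_i(n)\times n$ matrices $\mathbf G_i$ ($1\le i\le m$), $\mathbf b\in\mathbb{Z}_{p^r}^n$ and $t(1),\dots,t(l(n))\in\mathbb{Z}_{p^r}^n$ with all entries independent and uniform on $\mathbb{Z}_{p^r}$, and let $$\mathcal{C}=\Big\{\sum_{i=1}^m \mathbf u_i\mathbf G_i+\mathbf b:\ \mathbf u_i\in A_\epsilon^{(k_i(n))}(U_i),\ 1\le i\le m\Big\},\qquad \mathcal{C}_{out}=\bigcup_{j=1}^{l(n)}(\mathcal{C}+t(j)).$$ Let $(X,\hat X)$ be a pair of random variables, with $X$ on a finite alphabet and $\hat X$ uniform on $\mathbb{Z}_{p^r}$, and let $\mathbf X^n$ consist of $n$ independent copies of $X$, independent of $\mathcal{C}_{out}$. If $$R_{bin}+\frac{H([U]_s|Q)}{H(U|Q)}\,R>\log_2 p^s-H([\hat X]_s|X)\qquad\text{for all }1\le s\le r$$ (with $0/0:=0$ when $H(U|Q)=0$), then for every $\epsilon>0$ $$\lim_{n\to\infty}P\big\{\exists\,\hat{\mathbf x}\in\mathcal{C}_{out}:\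 (\mathbf X^n,\hat{\mathbf x})\in A^{(n)}_\epsilon(X,\hat X)\big\}=1 .$$ -/

import Mathlib

open Filter Topology
open scoped Matrix

namespace QGC

noncomputable section

/-- The law of `n` independent copies of a random variable with law `P` on a finite alphabet,
`P(x₁) ⋯ P(xₙ)`. -/
def iid {α : Type*} [Fintype α] (P : PMF α) (n : ℕ) : PMF (Fin n → α) :=
  PMF.ofFintype (fun x => ∏ j, P (x j)) (by
    classical
    rw [← Fintype.prod_sum (fun (_ : Fin n) (a : α) => P a)]
    have h : ∑ a, P a = 1 := by rw [← tsum_fintype (L := .unconditional α)]; exact P.tsum_coe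
    simp [h])

/-- The joint law of two independent random variables with laws `P` and `P'`. -/
def indep {α β : Type*} (P : PMF α) (P' : PMF β) : PMF (α × β) :=
  P.bind fun a => P'.map fun b => (a, b)

/-- The conditional entropy `H(A | B)` in bits, for a pair `(A, B)` with joint law `P`:
`- ∑ P(a, b) log₂ (P(a, b) / P_B(b))`, where terms with `P(a, b) = 0` vanish. -/
def condEntropy {α β : Type*} [Fintype α] [Fintype β] (P : PMF (α × β)) : ℝ :=
  -∑ a, ∑ b, (P (a, b)).toReal *
    Real.logb 2 ((P (a, b)).toReal / (P.map Prod.snd b).toReal)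

/-- The (strongly) `ε`-typical sequences of length `n` with respect to a law `P` on a finite
alphabet: every letter frequency is within `ε / |alphabet|` of its probability, and letters of
probability zero do not occur. -/
def typicalSet {α : Type*} [Fintype α] [DecidableEq α] (P : PMF α) (ε : ℝ) (n : ℕ) :
    Set (Fin n → α) :=
  {x | ∀ a : α,
    |((Finset.univ.filter fun j => x j = a).card : ℝ) / n - (P a).toReal|
        ≤ ε / Fintype.card α ∧
      (P a = 0 → ∀ j, x j ≠ a)}

/-- `[a]_s`: the unique `t ∈ {0, 1, …, p ^ s - 1}` with `a - t ∈ p ^ s ℤ_{p ^ r}` (for `s ≤ r`). -/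
def residue (p r s : ℕ) (a : ZMod (p ^ r)) : ZMod (p ^ r) :=
  ((a.val % p ^ s : ℕ) : ZMod (p ^ r))

/-- The joint law of `(U, Q)` when `Q ~ q` and, given `Q = i`, `U ~ U i`. -/
def mixture {α : Type*} {m : ℕ} (q : PMF (Fin m)) (U : Fin m → PMF α) : PMF (α × Fin m) :=
  q.bind fun i => (U i).map fun a => (a, i)

/-- The joint law of `([U]_s, Q)`. -/
def mixtureResidue (p r s : ℕ) {m : ℕ} (q : PMF (Fin m)) (U : Fin m → PMF (ZMod (p ^ r))) :
    PMF (ZMod (p ^ r) × Fin m) :=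
  (mixture q U).map fun z => (residue p r s z.1, z.2)

/-- For `(X, X̂) ~ P`, the joint law of `([X̂]_s, X)`. -/
def testResidue (p r s : ℕ) {α : Type*} (P : PMF (α × ZMod (p ^ r))) :
    PMF (ZMod (p ^ r) × α) :=
  P.map fun z => (residue p r s z.2, z.1)

/-- The quasi group code with matrices `G i`, translation `b` and random variables `U i`:
all `∑ i, u i * G i + b` with `u i` an `ε`-typical sequence of `U i`. -/
def code {N : ℕ} [NeZero N] {m n : ℕ} (ε : ℝ) {k : Fin m → ℕ} (U : Fin m → PMF (ZMod N))
    (G : (i : Fin m) → Matrix (Fin (k i)) (Fin n) (ZMod N)) (b : Fin n → ZMod N) :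
    Set (Fin n → ZMod N) :=
  {c | ∃ u : (i : Fin m) → Fin (k i) → ZMod N,
    (∀ i, u i ∈ typicalSet (U i) ε (k i)) ∧ c = (∑ i, u i ᵥ* G i) + b}

/-- The unionized code: the union of the shifts of the inner code `C` by `t j`. -/
def unionCode {N n l : ℕ} (C : Set (Fin n → ZMod N)) (t : Fin l → Fin n → ZMod N) :
    Set (Fin n → ZMod N) :=
  ⋃ j, (fun c => c + t j) '' C

/-- The parameters `(G, b, t)` of a unionized quasi group code over `ℤ_N`. -/
abbrev Params (N : ℕ) {m : ℕ} (n l : ℕ) (k : Fin m → ℕ) : Type :=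
  ((i : Fin m) → Matrix (Fin (k i)) (Fin n) (ZMod N)) ×
    (Fin n → ZMod N) × (Fin l → Fin n → ZMod N)

/-- The outer code with parameters `(G, b, t)`. -/
def outerCode {N : ℕ} [NeZero N] {m n l : ℕ} (ε : ℝ) {k : Fin m → ℕ}
    (U : Fin m → PMF (ZMod N)) (c : Params N n l k) : Set (Fin n → ZMod N) :=
  unionCode (code ε U c.1 c.2.1) c.2.2

/-- The law of the random experiment: all entries of all `G i`, of `b` and of all `t j` are
independent and uniform (that is, `(G, b, t)` is uniform), and, independently of them, the source
sequence consists of `n` independent letters with law `PX`. -/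
def experiment (N : ℕ) [NeZero N] {m : ℕ} {α : Type*} [Fintype α] (PX : PMF α) (n l : ℕ)
    (k : Fin m → ℕ) : PMF (Params N n l k × (Fin n → α)) :=
  indep (PMF.uniformOfFintype (Params N n l k)) (iid PX n)

/-- The probability that some codeword of the random outer code is jointly `ε`-typical with the
source sequence with respect to the joint law `P` of `(X, X̂)`. -/
def coveringProb {N : ℕ} [NeZero N] {m : ℕ} {α : Type*} [Fintype α] [DecidableEq α]
    (P : PMF (α × ZMod N)) (U : Fin m → PMF (ZMod N)) (ε : ℝ) (n l : ℕ) (k : Fin m → ℕ) :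
    ENNReal :=
  (experiment N (P.map Prod.fst) n l k).toOuterMeasure
    {ω | ∃ y ∈ outerCode ε U ω.1, (fun j => (ω.2 j, y j)) ∈ typicalSet P ε n}

end

end QGC

/-!
The proof is a second moment argument with weights in place of cardinalities.

Fix a small `δ ≤ ε`. Give the information sequences `u` the weight `w u` proportional to the
probability of `u` under independent i.i.d. letters with laws `U i`, restricted to `δ`-typical
sequences; given the source sequence `x`, give a reconstruction `y` the weight
`h y = ∏ⱼ P(yⱼ | xⱼ)`, restricted to those `y` which are jointly `δ`-typical with `x`. Let `Z` be the
suitably normalized total of `w u * h y` over the information sequences `u` and the shifts `j`,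
where `y` is the resulting codeword (`codeWeight`). Its mean given `x` is `F x = ∑ y, h y`, whose
average over `x` is the probability of joint typicality and so tends to one by Chebyshev's inequality
(`tendsto_typicalProb`). If no codeword covers `x`, then `Z = 0`, so it remains to bound the variance
of `Z` (`one_sub_coveringProb_le`).

A pair of codewords is an additive function of the uniform parameters `(G, b, t)`, hence uniform on
the range of that function. For different shifts the range is everything. For the same shift it
consists of the pairs `(y, y')` which agree modulo `p ^ s`, where `p ^ s` is the exact power of `p`
dividing the difference of the information sequences (`exists_range_codeword_prod`). Pairs with
`s = 0` are independent, and the others contribute at most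
`p ^ (s n) / l * (collision probability of u mod p ^ s) * (collision probability of y mod p ^ s)`
for `1 ≤ s ≤ r` (`sum_sq_codeWeight_sub_le`). By typicality these collision probabilities are about
`2 ^ (-∑ i, k i * H([U i]_s))` and `2 ^ (-n * H([X̂]_s | X))` (`collision_infoWeight_le`,
`sum_seqProb_mul_collision_le`), so that the rate conditions say precisely that each contribution
decays exponentially.
-/

namespace QGC

/-! ### Typical sequences -/

theorem sum_toReal {γ : Type*} [Fintype γ] (P : PMF γ) : ∑ a, (P a).toReal = 1 := by
  rw [← ENNReal.toReal_sum fun a _ => P.apply_ne_top a,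
    ← tsum_fintype (L := .unconditional γ), P.tsum_coe, ENNReal.toReal_one]

theorem toReal_le_one {γ : Type*} (P : PMF γ) (a : γ) : (P a).toReal ≤ 1 :=
  ENNReal.toReal_le_of_le_ofReal zero_le_one (by simpa using P.coe_le_one a)

theorem toReal_pos {γ : Type*} (P : PMF γ) {a : γ} (h : P a ≠ 0) : 0 < (P a).toReal :=
  ENNReal.toReal_pos h (P.apply_ne_top a)

/-- The probability `P(x₁) ⋯ P(xₙ)` of the sequence `x` under `n` independent copies of `P`, as a
real number. -/
noncomputable def seqProb {γ : Type*} (P : PMF γ) {n : ℕ} (x : Fin n → γ) : ℝ :=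
  ∏ j, (P (x j)).toReal

theorem seqProb_nonneg {γ : Type*} (P : PMF γ) {n : ℕ} (x : Fin n → γ) : 0 ≤ seqProb P x :=
  Finset.prod_nonneg fun _ _ => ENNReal.toReal_nonneg

theorem iid_toReal {γ : Type*} [Fintype γ] (P : PMF γ) {n : ℕ} (x : Fin n → γ) :
    (iid P n x).toReal = seqProb P x := by
  simp [iid, seqProb, ENNReal.toReal_prod]

theorem sum_prod_apply {γ : Type*} [Fintype γ] {n : ℕ} (g : Fin n → γ → ℝ) :
    ∑ x : Fin n → γ, ∏ j, g j (x j) = ∏ j, ∑ a, g j a := by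
  classical
  rw [Finset.prod_univ_sum, Fintype.piFinset_univ]

theorem sum_seqProb {γ : Type*} [Fintype γ] (P : PMF γ) (n : ℕ) :
    ∑ x : Fin n → γ, seqProb P x = 1 := by
  simp only [seqProb]
  rw [sum_prod_apply fun _ a => (P a).toReal]
  simp [sum_toReal]

/-- The covariance of a centred function `ψ` at two positions of an i.i.d. sequence. -/
theorem sum_seqProb_mul_mul_le {γ : Type*} [Fintype γ] (P : PMF γ) {n : ℕ} (ψ : γ → ℝ)
    (h0 : ∑ a, (P a).toReal * ψ a = 0) (h1 : ∀ a, |ψ a| ≤ 1) (i j : Fin n) :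
    ∑ x : Fin n → γ, seqProb P x * (ψ (x i) * ψ (x j)) ≤ if i = j then 1 else 0 := by
  classical
  split_ifs with hij
  · subst hij
    rw [← sum_seqProb P n]
    refine Finset.sum_le_sum fun x _ => mul_le_of_le_one_right (seqProb_nonneg P x) ?_
    have := h1 (x i)
    rw [← abs_mul_abs_self]
    exact mul_le_one₀ this (abs_nonneg _) this
  · refine le_of_eq ?_
    have key : ∀ x : Fin n → γ, seqProb P x * (ψ (x i) * ψ (x j)) =
        ∏ t, (P (x t)).toReal * ((if t = i then ψ (x t) else 1) *
          (if t = j then ψ (x t) else 1)) := by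
      intro x
      rw [Finset.prod_mul_distrib, Finset.prod_mul_distrib]
      simp [seqProb]
    simp_rw [key]
    rw [sum_prod_apply fun t a => (P a).toReal * ((if t = i then ψ a else 1) *
      (if t = j then ψ a else 1))]
    refine Finset.prod_eq_zero (Finset.mem_univ i) ?_
    simp [hij, h0]

/-- The number of occurrences of a letter in an i.i.d. sequence of length `n` has variance at most
`n`. -/
theorem sum_seqProb_mul_count_sq_le {γ : Type*} [Fintype γ] [DecidableEq γ] (P : PMF γ) (n : ℕ)
    (a : γ) :
    ∑ x : Fin n → γ, seqProb P x *
      (((Finset.univ.filter fun j => x j = a).card : ℝ) - n * (P a).toReal) ^ 2 ≤ n := by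
  set ψ : γ → ℝ := fun b => (if b = a then 1 else 0) - (P a).toReal with hψ
  have h0 : ∑ b, (P b).toReal * ψ b = 0 := by
    simp [hψ, mul_sub, Finset.sum_sub_distrib, ← Finset.sum_mul, sum_toReal]
  have h1 : ∀ b, |ψ b| ≤ 1 := by
    intro b
    have := toReal_le_one P a
    have h2 : 0 ≤ (P a).toReal := ENNReal.toReal_nonneg
    rw [abs_le]
    simp only [hψ]
    split_ifs <;> constructor <;> linarith
  have key : ∀ x : Fin n → γ,
      ((Finset.univ.filter fun j => x j = a).card : ℝ) - n * (P a).toReal = ∑ j, ψ (x j) := by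
    intro x
    simp [hψ, Finset.sum_sub_distrib]
  simp_rw [key, sq, Finset.sum_mul_sum, Finset.mul_sum]
  rw [Finset.sum_comm]
  calc ∑ i : Fin n, ∑ x : Fin n → γ, ∑ j, seqProb P x * (ψ (x i) * ψ (x j))
      = ∑ i : Fin n, ∑ j : Fin n, ∑ x : Fin n → γ, seqProb P x * (ψ (x i) * ψ (x j)) :=
        Finset.sum_congr rfl fun i _ => Finset.sum_comm
    _ ≤ ∑ i : Fin n, ∑ j : Fin n, if i = j then 1 else 0 :=
        Finset.sum_le_sum fun i _ => Finset.sum_le_sum fun j _ =>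
          sum_seqProb_mul_mul_le P ψ h0 h1 i j
    _ = n := by simp

theorem typicalSet_mono {γ : Type*} [Fintype γ] [DecidableEq γ] (P : PMF γ) {δ ε : ℝ}
    (h : δ ≤ ε) (n : ℕ) : typicalSet P δ n ⊆ typicalSet P ε n := fun _ hx a =>
  ⟨(hx a).1.trans (by gcongr), (hx a).2⟩

/-- The probability that an i.i.d. sequence is typical. -/
noncomputable def typicalProb {γ : Type*} [Fintype γ] [DecidableEq γ] (P : PMF γ) (δ : ℝ)
    (n : ℕ) : ℝ :=
  ∑ x : Fin n → γ, (typicalSet P δ n).indicator (seqProb P) x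

theorem typicalProb_le_one {γ : Type*} [Fintype γ] [DecidableEq γ] (P : PMF γ) (δ : ℝ) (n : ℕ) :
    typicalProb P δ n ≤ 1 := by
  rw [← sum_seqProb P n]
  exact Finset.sum_le_sum fun x _ => Set.indicator_le_self' (fun _ _ => seqProb_nonneg P _) x

/-- Chebyshev's inequality for the letter counts. -/
theorem one_sub_typicalProb_le {γ : Type*} [Fintype γ] [DecidableEq γ] (P : PMF γ) {δ : ℝ}
    (hδ : 0 < δ) {n : ℕ} (hn : 0 < n) :
    1 - typicalProb P δ n ≤ (Fintype.card γ : ℝ) ^ 3 / δ ^ 2 / n := by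
  obtain ⟨a₀, -⟩ := P.support_nonempty
  have hc : (0 : ℝ) < Fintype.card γ := by exact_mod_cast Fintype.card_pos_iff.2 ⟨a₀⟩
  have hn' : (0 : ℝ) < n := by exact_mod_cast hn
  set c : ℝ := (Fintype.card γ : ℝ) ^ 2 / (δ ^ 2 * n ^ 2) with hcdef
  have hc0 : 0 ≤ c := by positivity
  have key : ∀ x : Fin n → γ, seqProb P x - (typicalSet P δ n).indicator (seqProb P) x ≤
      ∑ a, c * (seqProb P x *
        (((Finset.univ.filter fun j => x j = a).card : ℝ) - n * (P a).toReal) ^ 2) := by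
    intro x
    have hnn : ∀ a ∈ Finset.univ, 0 ≤ c * (seqProb P x *
        (((Finset.univ.filter fun j => x j = a).card : ℝ) - n * (P a).toReal) ^ 2) :=
      fun a _ => mul_nonneg hc0 (mul_nonneg (seqProb_nonneg P x) (sq_nonneg _))
    by_cases hx : x ∈ typicalSet P δ n
    · rw [Set.indicator_of_mem hx, sub_self]
      exact Finset.sum_nonneg hnn
    · rw [Set.indicator_of_notMem hx, sub_zero]
      by_cases h0 : seqProb P x = 0
      · rw [h0]
        simp
      simp only [typicalSet, Set.mem_ofPred_eq, not_forall, not_and_or] at hx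
      obtain ⟨a, ha | ⟨ha, j, hj⟩⟩ := hx
      · refine le_trans ?_ (Finset.single_le_sum hnn (Finset.mem_univ a))
        rw [mul_left_comm]
        refine le_mul_of_one_le_right (seqProb_nonneg P x) ?_
        rw [not_le] at ha
        set k : ℝ := ((Finset.univ.filter fun j => x j = a).card : ℝ)
        have h1 : (δ / Fintype.card γ) ^ 2 ≤ (k / n - (P a).toReal) ^ 2 := by
          rw [← sq_abs (k / n - _)]
          gcongr
        have h2 : k - n * (P a).toReal = n * (k / n - (P a).toReal) := by
          field_simp
        rw [h2, mul_pow, hcdef]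
        calc (1 : ℝ) = (Fintype.card γ : ℝ) ^ 2 / (δ ^ 2 * n ^ 2) *
              (n ^ 2 * (δ / Fintype.card γ) ^ 2) := by field_simp
          _ ≤ _ := by gcongr
      · rw [not_not] at hj
        exact absurd (Finset.prod_eq_zero (Finset.mem_univ j) (by rw [hj, ha]; rfl)) h0
  calc 1 - typicalProb P δ n
      = ∑ x, (seqProb P x - (typicalSet P δ n).indicator (seqProb P) x) := by
        rw [Finset.sum_sub_distrib, sum_seqProb, typicalProb]
    _ ≤ ∑ x : Fin n → γ, ∑ a, c * (seqProb P x *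
        (((Finset.univ.filter fun j => x j = a).card : ℝ) - n * (P a).toReal) ^ 2) :=
        Finset.sum_le_sum fun x _ => key x
    _ = ∑ a, c * ∑ x : Fin n → γ, (seqProb P x *
        (((Finset.univ.filter fun j => x j = a).card : ℝ) - n * (P a).toReal) ^ 2) := by
        rw [Finset.sum_comm]
        simp_rw [Finset.mul_sum]
    _ ≤ ∑ _a : γ, c * n := by
        gcongr with a
        exact sum_seqProb_mul_count_sq_le P n a
    _ = (Fintype.card γ : ℝ) ^ 3 / δ ^ 2 / n := by
        simp only [Finset.sum_const, Finset.card_univ, nsmul_eq_mul, hcdef]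
        field_simp

theorem tendsto_typicalProb {γ : Type*} [Fintype γ] [DecidableEq γ] (P : PMF γ) {δ : ℝ}
    (hδ : 0 < δ) : Tendsto (typicalProb P δ) atTop (𝓝 1) := by
  have h : Tendsto (fun n : ℕ => 1 - (Fintype.card γ : ℝ) ^ 3 / δ ^ 2 / n) atTop (𝓝 1) := by
    simpa using (tendsto_const_div_atTop_nhds_zero_nat
      ((Fintype.card γ : ℝ) ^ 3 / δ ^ 2)).const_sub 1
  refine tendsto_of_tendsto_of_tendsto_of_le_of_le' h tendsto_const_nhds ?_
    (Eventually.of_forall (typicalProb_le_one P δ))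
  filter_upwards [eventually_gt_atTop 0] with n hn
  linarith [one_sub_typicalProb_le P hδ hn]

/-- Along a typical sequence, the average of `log₂ f` is close to its expectation; a letter of
probability zero does not occur, so `f` is only required to be positive on the support. -/
theorem prod_le_of_mem_typicalSet {γ : Type*} [Fintype γ] [DecidableEq γ] (P : PMF γ) (f : γ → ℝ)
    (hf : ∀ a, P a ≠ 0 → 0 < f a) {δ : ℝ} (hδ : 0 ≤ δ) {n : ℕ} {x : Fin n → γ}
    (hx : x ∈ typicalSet P δ n) :
    ∏ j, f (x j) ≤ (2 : ℝ) ^ ((n : ℝ) * (∑ a, (P a).toReal * Real.logb 2 (f a) +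
      δ * ∑ a, |Real.logb 2 (f a)|)) := by
  have h1 : ∏ j, f (x j) = (2 : ℝ) ^ (∑ j, Real.logb 2 (f (x j))) := by
    rw [Real.rpow_sum_of_pos two_pos]
    refine Finset.prod_congr rfl fun j _ => ?_
    rw [Real.rpow_logb two_pos (by norm_num)]
    exact hf _ fun h => (hx (x j)).2 h j rfl
  have h2 : ∑ j, Real.logb 2 (f (x j)) = ∑ a, ((Finset.univ.filter fun j => x j = a).card : ℝ) *
      Real.logb 2 (f a) := by
    rw [← Finset.sum_fiberwise Finset.univ x]
    refine Finset.sum_congr rfl fun a _ => ?_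
    rw [← nsmul_eq_mul, ← Finset.sum_const]
    exact Finset.sum_congr rfl fun j hj => by rw [(Finset.mem_filter.1 hj).2]
  rw [h1, h2]
  refine Real.rpow_le_rpow_of_exponent_le one_le_two ?_
  rw [Finset.mul_sum, ← Finset.sum_add_distrib, Finset.mul_sum]
  refine Finset.sum_le_sum fun a _ => ?_
  rcases Nat.eq_zero_or_pos n with rfl | hn
  · simp
  have hn' : (0 : ℝ) < n := by exact_mod_cast hn
  set k : ℝ := ((Finset.univ.filter fun j => x j = a).card : ℝ)
  have h3 : |k / n - (P a).toReal| ≤ δ := (hx a).1.trans <| div_le_self hδ <| by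
    exact_mod_cast Fintype.card_pos_iff.2 ⟨a⟩
  have h4 : k = n * ((P a).toReal + (k / n - (P a).toReal)) := by field_simp; ring
  have h5 : (k / n - (P a).toReal) * Real.logb 2 (f a) ≤ δ * |Real.logb 2 (f a)| :=
    (le_abs_self _).trans (by rw [abs_mul]; gcongr)
  rw [h4, mul_assoc, add_mul]
  gcongr (n : ℝ) * (_ + ?_)

/-! ### Homomorphisms of finite groups and pairs of codewords -/

/-- A homomorphism of finite groups pushes the counting measure forward to a multiple of the
counting measure on its range. -/
theorem sum_comp_hom_mul_card {A B : Type*} [AddGroup A] [Fintype A] [AddGroup B] [Fintype B]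
    (φ : A →+ B) (D : AddSubgroup B) (hD : φ.range = D) (f : B → ℝ) :
    (∑ θ, f (φ θ)) * Nat.card D = Fintype.card A * ∑ b, (D : Set B).indicator f b := by
  classical
  subst hD
  have hfib : ∀ b : B, ((Finset.univ.filter fun θ => φ θ = b).card : ℝ) =
      if b ∈ φ.range then (Nat.card φ.ker : ℝ) else 0 := by
    intro b
    split_ifs with hb
    · rw [Nat.card_eq_fintype_card, Fintype.card_subtype]
      norm_cast
      simpa only [AddMonoidHom.mem_ker] using
        AddMonoidHom.card_fiber_eq_of_mem_range φ hb ⟨0, map_zero φ⟩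
    · norm_cast
      rw [Finset.card_eq_zero, Finset.filter_eq_empty_iff]
      exact fun θ _ h => hb ⟨θ, h⟩
  have hcard : (Fintype.card A : ℝ) = Nat.card φ.ker * Nat.card φ.range := by
    rw [← Nat.card_eq_fintype_card, ← AddSubgroup.card_mul_index φ.ker, AddSubgroup.index_ker]
    push_cast
    rfl
  rw [← Finset.sum_fiberwise Finset.univ φ, hcard, Finset.sum_mul, Finset.mul_sum]
  refine Finset.sum_congr rfl fun b _ => ?_
  have : ∑ θ ∈ Finset.univ.filter (fun θ => φ θ = b), f (φ θ) =
      ((Finset.univ.filter fun θ => φ θ = b).card : ℝ) * f b := by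
    rw [← nsmul_eq_mul, ← Finset.sum_const]
    exact Finset.sum_congr rfl fun θ h => by rw [(Finset.mem_filter.1 h).2]
  rw [this, hfib, Set.indicator_apply]
  simp only [SetLike.mem_coe]
  split_ifs <;> ring

/-- The average of `f (φ θ)` over a finite group when the range `D` of the homomorphism `φ` has
index at most `M`. -/
theorem sum_comp_hom_le {A B : Type*} [AddGroup A] [Fintype A] [AddGroup B] [Fintype B]
    (φ : A →+ B) (D : AddSubgroup B) (hD : φ.range = D) (M : ℝ)
    (hM : (Fintype.card B : ℝ) ≤ Nat.card D * M) (f : B → ℝ) (hf : ∀ b, 0 ≤ f b) :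
    Fintype.card B * ∑ θ, f (φ θ) ≤ Fintype.card A * (M * ∑ b, (D : Set B).indicator f b) := by
  have h := sum_comp_hom_mul_card φ D hD f
  have h0 : 0 ≤ ∑ θ, f (φ θ) := Finset.sum_nonneg fun _ _ => hf _
  calc (Fintype.card B : ℝ) * ∑ θ, f (φ θ) ≤ Nat.card D * M * ∑ θ, f (φ θ) := by gcongr
    _ = (∑ θ, f (φ θ)) * Nat.card D * M := by ring
    _ = _ := by rw [h]; ring

/-- Reduction modulo `p ^ s` on `ℤ_{p ^ r}`. -/
def reduce (p r s : ℕ) (hs : s ≤ r) : ZMod (p ^ r) →+* ZMod (p ^ s) :=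
  ZMod.castHom (pow_dvd_pow p hs) (ZMod (p ^ s))

section Reduce

variable {p r s : ℕ} [Fact p.Prime] (hs : s ≤ r)

theorem reduce_eq_natCast (a : ZMod (p ^ r)) : reduce p r s hs a = (a.val : ZMod (p ^ s)) := by
  conv_lhs => rw [← ZMod.natCast_zmod_val a]
  simp [reduce]

theorem residue_eq_of_reduce_eq {a b : ZMod (p ^ r)} (h : reduce p r s hs a = reduce p r s hs b) :
    residue p r s a = residue p r s b := by
  rw [reduce_eq_natCast, reduce_eq_natCast, ZMod.natCast_eq_natCast_iff'] at h
  rw [residue, residue, h]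

theorem reduce_eq_zero_iff {a : ZMod (p ^ r)} :
    reduce p r s hs a = 0 ↔ ((p ^ s : ℕ) : ZMod (p ^ r)) ∣ a := by
  constructor
  · intro h
    rw [reduce_eq_natCast, ZMod.natCast_eq_zero_iff] at h
    rw [← ZMod.natCast_zmod_val a]
    exact Nat.cast_dvd_cast h
  · rintro ⟨c, rfl⟩
    rw [map_mul, map_natCast, ZMod.natCast_self, zero_mul]

end Reduce

/-- A vector over `ℤ_{p ^ r}` is `p ^ s` times a vector which is zero or has a unit entry. -/
theorem exists_pow_dvd_unit {p r : ℕ} [Fact p.Prime] {ι : Type*} (d : ι → ZMod (p ^ r)) :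
    ∃ s ≤ r, (∀ i, ((p ^ s : ℕ) : ZMod (p ^ r)) ∣ d i) ∧
      (s = r ∨ ∃ i, ∃ v : (ZMod (p ^ r))ˣ, d i = ((p ^ s : ℕ) : ZMod (p ^ r)) * v) := by
  classical
  set Q : ℕ → Prop := fun s => ∀ i, ((p ^ s : ℕ) : ZMod (p ^ r)) ∣ d i with hQ
  have h0 : Q 0 := fun i => by simp
  refine ⟨Nat.findGreatest Q r, Nat.findGreatest_le r,
    Nat.findGreatest_spec (P := Q) (Nat.zero_le r) h0, ?_⟩
  rcases (Nat.findGreatest_le (P := Q) r).eq_or_lt with h | h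
  · exact Or.inl h
  right
  have hspec := Nat.findGreatest_spec (P := Q) (Nat.zero_le r) h0
  have hnot := Nat.findGreatest_is_greatest (Nat.lt_succ_self (Nat.findGreatest Q r)) h
  set s := Nat.findGreatest Q r
  simp only [hQ, not_forall] at hnot
  obtain ⟨i, hi⟩ := hnot
  obtain ⟨e, he⟩ := hspec i
  have hunit : IsUnit e := by
    rw [← ZMod.natCast_zmod_val e, ZMod.isUnit_iff_coprime]
    refine Nat.Coprime.pow_right r (Nat.Coprime.symm ?_)
    rw [Nat.Prime.coprime_iff_not_dvd Fact.out]
    intro hdvd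
    refine hi ?_
    rw [he, pow_succ, Nat.cast_mul]
    refine mul_dvd_mul_left _ ?_
    rw [← ZMod.natCast_zmod_val e]
    exact Nat.cast_dvd_cast hdvd
  obtain ⟨v, rfl⟩ := hunit
  exact ⟨i, v, he⟩

/-- The codeword with information sequences `u` and shift `t j`, as an additive function of the
random parameters `(G, b, t)`. -/
def codeword {N m n l : ℕ} {k : Fin m → ℕ} (u : (i : Fin m) → Fin (k i) → ZMod N) (j : Fin l) :
    Params N n l k →+ (Fin n → ZMod N) :=
  AddMonoidHom.mk' (fun c => (∑ i, u i ᵥ* c.1 i) + c.2.1 + c.2.2 j) (by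
    intro c c'
    simp only [Prod.fst_add, Prod.snd_add, Pi.add_apply, Matrix.vecMul_add, Finset.sum_add_distrib]
    abel)

theorem codeword_apply {N m n l : ℕ} {k : Fin m → ℕ} (u : (i : Fin m) → Fin (k i) → ZMod N)
    (j : Fin l) (c : Params N n l k) :
    codeword u j c = (∑ i, u i ᵥ* c.1 i) + c.2.1 + c.2.2 j := rfl

theorem codeword_surjective {N m n l : ℕ} {k : Fin m → ℕ}
    (u : (i : Fin m) → Fin (k i) → ZMod N) (j : Fin l) :
    Function.Surjective (codeword (n := n) u j) := fun y =>
  ⟨(0, y, 0), by simp [codeword_apply]⟩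

/-- The pairs of vectors over `ℤ_{p ^ r}` which agree modulo `p ^ s`. -/
def agreeSubgroup (p r s n : ℕ) (hs : s ≤ r) :
    AddSubgroup ((Fin n → ZMod (p ^ r)) × (Fin n → ZMod (p ^ r))) :=
  ((AddMonoidHom.compLeft (reduce p r s hs).toAddMonoidHom (Fin n)).comp
    (AddMonoidHom.fst _ _ - AddMonoidHom.snd _ _)).ker

theorem mem_agreeSubgroup {p r s n : ℕ} (hs : s ≤ r)
    {y : (Fin n → ZMod (p ^ r)) × (Fin n → ZMod (p ^ r))} :
    y ∈ agreeSubgroup p r s n hs ↔ ∀ j, reduce p r s hs (y.1 j - y.2 j) = 0 := by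
  simp [agreeSubgroup, AddMonoidHom.mem_ker, funext_iff]

/-- The pairs which agree modulo `p ^ s` form a subgroup of index at most `p ^ (s n)`. -/
theorem card_le_card_agreeSubgroup {p r s n : ℕ} [Fact p.Prime] (hs : s ≤ r) :
    (Fintype.card ((Fin n → ZMod (p ^ r)) × (Fin n → ZMod (p ^ r))) : ℝ) ≤
      Nat.card (agreeSubgroup p r s n hs) * ((p : ℝ) ^ s) ^ n := by
  rw [← Nat.card_eq_fintype_card, ← AddSubgroup.card_mul_index (agreeSubgroup p r s n hs),
    agreeSubgroup, AddSubgroup.index_ker]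
  push_cast
  gcongr
  have h := Nat.card_le_card_of_injective _ (Subtype.val_injective (p := fun x => x ∈
    ((AddMonoidHom.compLeft (reduce p r s hs).toAddMonoidHom (Fin n)).comp
    (AddMonoidHom.fst _ _ - AddMonoidHom.snd _ _)).range))
  have h2 : Nat.card (Fin n → ZMod (p ^ s)) = (p ^ s) ^ n := by simp
  rw [h2] at h
  exact_mod_cast h

/-- Two codewords with the same shift jointly range over all pairs which agree modulo `p ^ s`,
where `p ^ s` is the exact power of `p` dividing the difference of their information sequences. -/
theorem exists_range_codeword_prod {p r m n l : ℕ} [Fact p.Prime] {k : Fin m → ℕ}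
    (u u' : (i : Fin m) → Fin (k i) → ZMod (p ^ r)) (j : Fin l) :
    ∃ s, ∃ hs : s ≤ r, (∀ i t, residue p r s (u i t) = residue p r s (u' i t)) ∧
      ((codeword (n := n) u j).prod (codeword u' j)).range = agreeSubgroup p r s n hs := by
  classical
  obtain ⟨s, hs, hdvd, hunit⟩ := exists_pow_dvd_unit
    (fun z : (i : Fin m) × Fin (k i) => u z.1 z.2 - u' z.1 z.2)
  have hred : ∀ i t, reduce p r s hs (u i t - u' i t) = 0 := fun i t =>
    (reduce_eq_zero_iff hs).2 (hdvd ⟨i, t⟩)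
  refine ⟨s, hs, fun i t => residue_eq_of_reduce_eq hs ?_, le_antisymm ?_ ?_⟩
  · rw [← sub_eq_zero, ← map_sub, hred]
  · rintro _ ⟨c, rfl⟩
    rw [mem_agreeSubgroup]
    intro x
    have : (codeword u j c - codeword u' j c) x =
        ∑ i, ∑ t, (u i t - u' i t) * c.1 i t x := by
      simp [codeword_apply, Matrix.vecMul, dotProduct, sub_mul, Finset.sum_sub_distrib]
    rw [Pi.sub_apply] at this
    simp [this, hred]
  · rintro ⟨y, y'⟩ hy
    rw [mem_agreeSubgroup] at hy
    obtain ⟨G, hG⟩ : ∃ G : (i : Fin m) → Matrix (Fin (k i)) (Fin n) (ZMod (p ^ r)),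
        ∑ i, (u i - u' i) ᵥ* G i = y - y' := by
      rcases hunit with rfl | ⟨⟨i₀, t₀⟩, v, hv⟩
      · refine ⟨0, ?_⟩
        funext x
        have h := (reduce_eq_zero_iff hs).1 (hy x)
        rw [ZMod.natCast_self, zero_dvd_iff] at h
        simp [h]
      · choose z hz using fun x => (reduce_eq_zero_iff hs).1 (hy x)
        refine ⟨fun i => Matrix.of fun t x =>
          if (⟨i, t⟩ : (i : Fin m) × Fin (k i)) = ⟨i₀, t₀⟩ then ((v⁻¹ : _ˣ) : ZMod (p ^ r)) * z x
            else 0, ?_⟩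
        funext x
        simp only [Finset.sum_apply, Matrix.vecMul, dotProduct, Matrix.of_apply, Pi.sub_apply]
        rw [← Fintype.sum_sigma' (fun i t => (u i t - u' i t) *
          if (⟨i, t⟩ : (i : Fin m) × Fin (k i)) = ⟨i₀, t₀⟩ then ((v⁻¹ : _ˣ) : ZMod (p ^ r)) * z x
            else 0), Finset.sum_eq_single ⟨i₀, t₀⟩]
        · simp only at hv hz
          rw [if_pos rfl, hv, hz, mul_assoc, Units.mul_inv_cancel_left]
        · intro b _ hb
          rw [if_neg hb, mul_zero]
        · simp
    refine ⟨(G, y - ∑ i, u i ᵥ* G i, 0), ?_⟩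
    have h2 : ∑ i, u' i ᵥ* G i = ∑ i, u i ᵥ* G i - (y - y') := by
      rw [← hG]
      simp [Matrix.sub_vecMul]
    simp [codeword_apply, h2]

/-- Codewords with different shifts are independent. -/
theorem range_codeword_prod_of_ne {N m n l : ℕ} {k : Fin m → ℕ}
    (u u' : (i : Fin m) → Fin (k i) → ZMod N) {j j' : Fin l} (h : j ≠ j') :
    ((codeword (n := n) u j).prod (codeword u' j')).range = ⊤ := by
  classical
  refine AddMonoidHom.range_eq_top.2 fun y => ⟨(0, 0, Pi.single j y.1 + Pi.single j' y.2), ?_⟩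
  simp [codeword_apply, h, h.symm]

/-! ### The variance of the weight of the random code -/

/-- A bound on the variance of a convex combination of random variables `f i` with the same mean
`F`, over a uniformly distributed `θ`. -/
theorem sum_sq_sub_le {Θ I : Type*} [Fintype Θ] [Fintype I] (a : I → ℝ) (ha : ∀ i, 0 ≤ a i)
    (ha1 : ∑ i, a i = 1) (f : I → Θ → ℝ) (F : ℝ) (hF : ∀ i, ∑ θ, f i θ = Fintype.card Θ * F)
    (κ : I → I → ℝ)
    (hκ : ∀ i i', ∑ θ, f i θ * f i' θ ≤ Fintype.card Θ * (F ^ 2 + κ i i')) :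
    ∑ θ, ((∑ i, a i * f i θ) - F) ^ 2 ≤ Fintype.card Θ * ∑ i, ∑ i', a i * a i' * κ i i' := by
  have h1 : ∑ θ, ∑ i, a i * f i θ = Fintype.card Θ * F := by
    rw [Finset.sum_comm]
    simp_rw [← Finset.mul_sum, hF]
    rw [← Finset.sum_mul, ha1, one_mul]
  have h2 : ∑ θ, (∑ i, a i * f i θ) ^ 2 ≤
      Fintype.card Θ * (F ^ 2 + ∑ i, ∑ i', a i * a i' * κ i i') := by
    calc ∑ θ, (∑ i, a i * f i θ) ^ 2
        = ∑ i, ∑ i', a i * a i' * ∑ θ, f i θ * f i' θ := by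
          simp_rw [sq, Finset.sum_mul_sum]
          rw [Finset.sum_comm]
          refine Finset.sum_congr rfl fun i _ => ?_
          rw [Finset.sum_comm]
          refine Finset.sum_congr rfl fun i' _ => ?_
          rw [Finset.mul_sum]
          exact Finset.sum_congr rfl fun θ _ => by ring
      _ ≤ ∑ i, ∑ i', a i * a i' * (Fintype.card Θ * (F ^ 2 + κ i i')) :=
          Finset.sum_le_sum fun i _ => Finset.sum_le_sum fun i' _ =>
            mul_le_mul_of_nonneg_left (hκ i i') (mul_nonneg (ha i) (ha i'))
      _ = Fintype.card Θ * ((∑ i, a i) * (∑ i', a i') * F ^ 2 +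
            ∑ i, ∑ i', a i * a i' * κ i i') := by
          rw [Finset.sum_mul_sum, mul_add, Finset.sum_mul, Finset.mul_sum, Finset.mul_sum,
            ← Finset.sum_add_distrib]
          refine Finset.sum_congr rfl fun i _ => ?_
          rw [Finset.sum_mul, Finset.mul_sum, Finset.mul_sum, ← Finset.sum_add_distrib]
          exact Finset.sum_congr rfl fun i' _ => by ring
      _ = _ := by rw [ha1]; ring
  have h3 : ∑ θ, ((∑ i, a i * f i θ) - F) ^ 2 = ∑ θ, (∑ i, a i * f i θ) ^ 2 -
      2 * F * (∑ θ, ∑ i, a i * f i θ) + Fintype.card Θ * F ^ 2 := by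
    simp_rw [sub_sq, Finset.sum_add_distrib, Finset.sum_sub_distrib, ← Finset.sum_mul,
      ← Finset.mul_sum]
    simp
    ring
  rw [h3, h1]
  linarith

open Classical in
/-- For weights `w` on a finite type, the total weight of the pairs with the same image under `π`:
the collision probability of `π` when `w` is a probability distribution. -/
noncomputable def collision {E F : Type*} [Fintype E] (π : E → F) (w : E → ℝ) : ℝ :=
  ∑ x, ∑ y, if π x = π y then w x * w y else 0

theorem collision_nonneg {E F : Type*} [Fintype E] (π : E → F) {w : E → ℝ} (hw : ∀ x, 0 ≤ w x) :
    0 ≤ collision π w :=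
  Finset.sum_nonneg fun x _ => Finset.sum_nonneg fun y _ => by
    split_ifs
    exacts [mul_nonneg (hw x) (hw y), le_rfl]

theorem collision_le_sq {E F : Type*} [Fintype E] (π : E → F) {w : E → ℝ} (hw : ∀ x, 0 ≤ w x) :
    collision π w ≤ (∑ x, w x) ^ 2 := by
  rw [sq, Finset.sum_mul_sum]
  refine Finset.sum_le_sum fun x _ => Finset.sum_le_sum fun y _ => ?_
  split_ifs
  exacts [le_rfl, mul_nonneg (hw x) (hw y)]

theorem collision_const_mul {E F : Type*} [Fintype E] (π : E → F) (w : E → ℝ) (c : ℝ) :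
    collision π (fun x => c * w x) = c ^ 2 * collision π w := by
  simp only [collision, Finset.mul_sum]
  refine Finset.sum_congr rfl fun x _ => Finset.sum_congr rfl fun y _ => ?_
  split_ifs <;> ring

/-- The residues modulo `p ^ s` of the entries of a vector. -/
def vecResidue (p r s n : ℕ) (y : Fin n → ZMod (p ^ r)) : Fin n → ZMod (p ^ r) :=
  fun x => residue p r s (y x)

/-- The residues modulo `p ^ s` of the entries of a family of information sequences. -/
def infoResidue (p r s : ℕ) {m : ℕ} (k : Fin m → ℕ) (u : (i : Fin m) → Fin (k i) → ZMod (p ^ r)) :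
    (i : Fin m) → Fin (k i) → ZMod (p ^ r) :=
  fun i t => residue p r s (u i t)

section SecondMoment

variable {p r m n l : ℕ} [Fact p.Prime] {k : Fin m → ℕ}

theorem sum_indicator_agreeSubgroup_le {s : ℕ} (hs : s ≤ r) {h : (Fin n → ZMod (p ^ r)) → ℝ}
    (hh : ∀ y, 0 ≤ h y) :
    ∑ b, (agreeSubgroup p r s n hs : Set _).indicator
      (fun b : (Fin n → ZMod (p ^ r)) × (Fin n → ZMod (p ^ r)) => h b.1 * h b.2) b ≤
      collision (vecResidue p r s n) h := by
  classical
  rw [Fintype.sum_prod_type]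
  refine Finset.sum_le_sum fun y _ => Finset.sum_le_sum fun y' _ => ?_
  rw [Set.indicator_apply]
  by_cases hy : (y, y') ∈ (agreeSubgroup p r s n hs : Set _)
  · have hy' : vecResidue p r s n y = vecResidue p r s n y' := by
      funext x
      have := (mem_agreeSubgroup hs).1 hy x
      rw [map_sub, sub_eq_zero] at this
      exact residue_eq_of_reduce_eq hs this
    rw [if_pos hy, if_pos hy']
  · rw [if_neg hy]
    split_ifs
    exacts [mul_nonneg (hh y) (hh y'), le_rfl]

theorem sum_codeword_eq {N : ℕ} [NeZero N] (u : (i : Fin m) → Fin (k i) → ZMod N) (j : Fin l)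
    (h : (Fin n → ZMod N) → ℝ) :
    ∑ c : Params N n l k, (Fintype.card (Fin n → ZMod N) : ℝ) * h (codeword u j c) =
      Fintype.card (Params N n l k) * ∑ y, h y := by
  have := sum_comp_hom_mul_card (codeword (n := n) (k := k) u j) ⊤
    (AddMonoidHom.range_eq_top.2 (codeword_surjective u j)) h
  rw [← Finset.mul_sum, mul_comm]
  simpa [Nat.card_eq_fintype_card] using this

open Classical in
/-- The correlation of a function `h` at two random codewords. For distinct shifts they are
independent; otherwise the excess over the independent case is a collision sum. -/
theorem sum_codeword_mul_codeword_le (u u' : (i : Fin m) → Fin (k i) → ZMod (p ^ r))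
    (j j' : Fin l) {h : (Fin n → ZMod (p ^ r)) → ℝ} (hh : ∀ y, 0 ≤ h y) :
    ∑ c : Params (p ^ r) n l k,
        ((Fintype.card (Fin n → ZMod (p ^ r)) : ℝ) * h (codeword u j c)) *
        ((Fintype.card (Fin n → ZMod (p ^ r)) : ℝ) * h (codeword u' j' c)) ≤
      Fintype.card (Params (p ^ r) n l k) * ((∑ y, h y) ^ 2 + if j = j' then
        ∑ s ∈ Finset.Icc 1 r, (if infoResidue p r s k u = infoResidue p r s k u' then
          ((p : ℝ) ^ s) ^ n * collision (vecResidue p r s n) h else 0) else 0) := by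
  have hcard : ((Fintype.card (Fin n → ZMod (p ^ r)) : ℝ)) *
      (Fintype.card (Fin n → ZMod (p ^ r)) : ℝ) =
      Fintype.card ((Fin n → ZMod (p ^ r)) × (Fin n → ZMod (p ^ r))) := by
    rw [Fintype.card_prod]
    push_cast
    rfl
  simp_rw [mul_mul_mul_comm, hcard, ← Finset.mul_sum]
  have hf : ∀ b : (Fin n → ZMod (p ^ r)) × (Fin n → ZMod (p ^ r)), 0 ≤ h b.1 * h b.2 :=
    fun b => mul_nonneg (hh _) (hh _)
  by_cases hj : j = j'
  · subst hj
    rw [if_pos rfl]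
    obtain ⟨s, hs, hres, hrange⟩ := exists_range_codeword_prod (n := n) u u' j
    have hres' : infoResidue p r s k u = infoResidue p r s k u' := by
      funext i t
      exact hres i t
    refine (sum_comp_hom_le _ _ hrange (((p : ℝ) ^ s) ^ n)
      (card_le_card_agreeSubgroup hs) (fun b => h b.1 * h b.2) hf).trans ?_
    refine mul_le_mul_of_nonneg_left ?_ (Nat.cast_nonneg _)
    refine (mul_le_mul_of_nonneg_left (sum_indicator_agreeSubgroup_le hs hh)
      (by positivity)).trans ?_
    have hnn : ∀ s' ∈ Finset.Icc 1 r,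
        0 ≤ (if infoResidue p r s' k u = infoResidue p r s' k u' then
          ((p : ℝ) ^ s') ^ n * collision (vecResidue p r s' n) h else 0) := by
      intro s' _
      have := collision_nonneg (vecResidue p r s' n) hh
      split_ifs <;> positivity
    rcases Nat.eq_zero_or_pos s with rfl | hs0
    · have := collision_le_sq (vecResidue p r 0 n) hh
      have h2 := Finset.sum_nonneg hnn
      simp only [pow_zero, one_pow, one_mul]
      linarith
    · have h2 := Finset.single_le_sum hnn (Finset.mem_Icc.2 ⟨hs0, hs⟩)
      rw [if_pos hres'] at h2
      have := sq_nonneg (∑ y, h y)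
      linarith
  · rw [if_neg hj, add_zero]
    refine (sum_comp_hom_le _ _ (range_codeword_prod_of_ne (n := n) u u' hj) 1 (by simp)
      (fun b => h b.1 * h b.2) hf).trans (le_of_eq ?_)
    rw [one_mul, sq, Finset.sum_mul_sum, Fintype.sum_prod_type]
    simp

/-- The `h`-weight of the outer code with parameters `c`, when the codeword with information
sequences `u` and any of the `l` shifts is counted with multiplicity `w u / l`. It is normalized
so that its expectation is `(∑ u, w u) * ∑ y, h y`. -/
noncomputable def codeWeight {N : ℕ} [NeZero N] (w : ((i : Fin m) → Fin (k i) → ZMod N) → ℝ)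
    (h : (Fin n → ZMod N) → ℝ) (c : Params N n l k) : ℝ :=
  ∑ z : ((i : Fin m) → Fin (k i) → ZMod N) × Fin l,
    w z.1 / l * ((Fintype.card (Fin n → ZMod N) : ℝ) * h (codeword z.1 z.2 c))

/-- The variance of the weight of the random outer code, in terms of the collision probabilities
of the information sequences and of the weight `h` modulo the powers of `p`. -/
theorem sum_sq_codeWeight_sub_le (hl : 0 < l) {w : ((i : Fin m) → Fin (k i) → ZMod (p ^ r)) → ℝ}
    (hw : ∀ u, 0 ≤ w u) (hw1 : ∑ u, w u = 1) {h : (Fin n → ZMod (p ^ r)) → ℝ}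
    (hh : ∀ y, 0 ≤ h y) :
    ∑ c : Params (p ^ r) n l k, (codeWeight w h c - ∑ y, h y) ^ 2 ≤
      Fintype.card (Params (p ^ r) n l k) * ∑ s ∈ Finset.Icc 1 r,
        ((p : ℝ) ^ s) ^ n / l * collision (infoResidue p r s k) w *
          collision (vecResidue p r s n) h := by
  classical
  have hl' : (l : ℝ) ≠ 0 := by exact_mod_cast hl.ne'
  refine (sum_sq_sub_le (fun z : ((i : Fin m) → Fin (k i) → ZMod (p ^ r)) × Fin l => w z.1 / l)
    (fun z => div_nonneg (hw _) (Nat.cast_nonneg _)) ?_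
    (fun z (c : Params (p ^ r) n l k) =>
      ((Fintype.card (Fin n → ZMod (p ^ r)) : ℝ) * h (codeword z.1 z.2 c)))
    (∑ y, h y) (fun z => sum_codeword_eq z.1 z.2 h)
    (fun z z' => if z.2 = z'.2 then
        ∑ s ∈ Finset.Icc 1 r, (if infoResidue p r s k z.1 = infoResidue p r s k z'.1 then
          ((p : ℝ) ^ s) ^ n * collision (vecResidue p r s n) h else 0) else 0)
    (fun z z' => sum_codeword_mul_codeword_le z.1 z'.1 z.2 z'.2 hh)).trans (le_of_eq ?_)
  · rw [Fintype.sum_prod_type]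
    simp only [Finset.sum_const, Finset.card_univ, Fintype.card_fin, nsmul_eq_mul]
    rw [← hw1]
    exact Finset.sum_congr rfl fun u _ => by field_simp
  · congr 1
    calc _ = ∑ u : (i : Fin m) → Fin (k i) → ZMod (p ^ r), ∑ _j : Fin l,
          ∑ u' : (i : Fin m) → Fin (k i) → ZMod (p ^ r), w u / l * (w u' / l) *
          ∑ s ∈ Finset.Icc 1 r, (if infoResidue p r s k u = infoResidue p r s k u' then
            ((p : ℝ) ^ s) ^ n * collision (vecResidue p r s n) h else 0) := by
          simp only [Fintype.sum_prod_type]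
          refine Finset.sum_congr rfl fun u _ => Finset.sum_congr rfl fun j _ =>
            Finset.sum_congr rfl fun u' _ => ?_
          rw [Finset.sum_eq_single j (fun j' _ hj => by rw [if_neg hj.symm, mul_zero])
            (fun hj => absurd (Finset.mem_univ j) hj), if_pos rfl]
      _ = ∑ u : (i : Fin m) → Fin (k i) → ZMod (p ^ r),
          ∑ u' : (i : Fin m) → Fin (k i) → ZMod (p ^ r), ∑ s ∈ Finset.Icc 1 r,
          ((p : ℝ) ^ s) ^ n / l *
          (if infoResidue p r s k u = infoResidue p r s k u' then w u * w u' else 0) *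
          collision (vecResidue p r s n) h := by
          refine Finset.sum_congr rfl fun u _ => ?_
          rw [Finset.sum_const, Finset.card_univ, Fintype.card_fin, nsmul_eq_mul, Finset.mul_sum]
          refine Finset.sum_congr rfl fun u' _ => ?_
          rw [Finset.mul_sum, Finset.mul_sum]
          refine Finset.sum_congr rfl fun s _ => ?_
          split_ifs
          · field_simp
          · simp
      _ = _ := by
          refine (Finset.sum_congr rfl fun u _ => Finset.sum_comm).trans
            (Finset.sum_comm.trans (Finset.sum_congr rfl fun s _ => ?_))
          rw [collision.eq_def (infoResidue p r s k) w, Finset.mul_sum, Finset.sum_mul]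
          refine Finset.sum_congr rfl fun u _ => ?_
          rw [Finset.mul_sum, Finset.sum_mul]
          refine Finset.sum_congr rfl fun u' _ => ?_
          congr!

end SecondMoment

/-! ### Collision probabilities of typical sequences -/

open Classical in
/-- The total weight of the letters with the same image under `π` as `a`. -/
noncomputable def classSum {γ F : Type*} [Fintype γ] (π : γ → F) (v : γ → ℝ) (a : γ) : ℝ :=
  ∑ b, if π a = π b then v b else 0

theorem le_classSum {γ F : Type*} [Fintype γ] (π : γ → F) {v : γ → ℝ} (hv : ∀ a, 0 ≤ v a)
    (a : γ) : v a ≤ classSum π v a := by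
  classical
  have := Finset.single_le_sum (f := fun b => if π a = π b then v b else 0)
    (fun b _ => by split_ifs; exacts [hv b, le_rfl]) (Finset.mem_univ a)
  simpa [classSum] using this

/-- Dropping the typicality constraint on the second of two colliding sequences leaves a sum which
factorizes over the positions. -/
theorem collision_indicator_prod_le {γ F : Type*} [Fintype γ] (π : γ → F) {n : ℕ}
    (v : Fin n → γ → ℝ) (hv : ∀ j a, 0 ≤ v j a) (T : Set (Fin n → γ)) :
    collision (fun (y : Fin n → γ) j => π (y j)) (T.indicator fun y => ∏ j, v j (y j)) ≤
      ∑ y, T.indicator (fun y => ∏ j, v j (y j) * classSum π (v j) (y j)) y := by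
  classical
  have h0 : ∀ y : Fin n → γ, 0 ≤ ∏ j, v j (y j) := fun y =>
    Finset.prod_nonneg fun j _ => hv j _
  refine Finset.sum_le_sum fun y _ => ?_
  by_cases hy : y ∈ T
  · simp only [Set.indicator_of_mem hy, Finset.prod_mul_distrib]
    have h1 : ∏ j, classSum π (v j) (y j) =
        ∑ y' : Fin n → γ, ∏ j, if π (y j) = π (y' j) then v j (y' j) else 0 := by
      rw [sum_prod_apply fun j b => if π (y j) = π b then v j b else 0]
      refine Finset.prod_congr rfl fun j _ => ?_
      rw [classSum]
    rw [h1, Finset.mul_sum]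
    refine Finset.sum_le_sum fun y' _ => ?_
    split_ifs with h
    · have h2 : ∏ j, (if π (y j) = π (y' j) then v j (y' j) else 0) = ∏ j, v j (y' j) :=
        Finset.prod_congr rfl fun j _ => if_pos (congrFun h j)
      rw [h2]
      exact mul_le_mul_of_nonneg_left
        (Set.indicator_le_self' (fun _ _ => h0 _) y') (h0 y)
    · refine mul_nonneg (h0 y) (Finset.prod_nonneg fun j _ => ?_)
      split_ifs
      exacts [hv j _, le_rfl]
  · simp [Set.indicator_of_notMem hy]

/-- Collision weights are multiplicative over product spaces. -/
theorem collision_pi {ι : Type*} [Fintype ι] [DecidableEq ι] {E F : ι → Type*}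
    [∀ i, Fintype (E i)] (π : ∀ i, E i → F i) (w : ∀ i, E i → ℝ) :
    collision (fun (u : ∀ i, E i) i => π i (u i)) (fun u => ∏ i, w i (u i)) =
      ∏ i, collision (π i) (w i) := by
  classical
  simp only [collision]
  rw [Finset.prod_univ_sum, Fintype.piFinset_univ]
  refine Finset.sum_congr rfl fun u _ => ?_
  rw [Finset.prod_univ_sum, Fintype.piFinset_univ]
  refine Finset.sum_congr rfl fun u' _ => ?_
  split_ifs with h
  · rw [← Finset.prod_mul_distrib]
    exact Finset.prod_congr rfl fun i _ => (if_pos (congrFun h i)).symm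
  · rw [funext_iff, not_forall] at h
    obtain ⟨i, hi⟩ := h
    exact (Finset.prod_eq_zero (Finset.mem_univ i) (if_neg hi)).symm

/-- The bound on `n⁻¹ log₂ ∏ⱼ f (xⱼ)` for `δ`-typical sequences `x`. -/
noncomputable def typicalExponent {γ : Type*} [Fintype γ] (P : PMF γ) (f : γ → ℝ) (δ : ℝ) : ℝ :=
  ∑ a, (P a).toReal * Real.logb 2 (f a) + δ * ∑ a, |Real.logb 2 (f a)|

theorem sum_indicator_mul_prod_le {γ : Type*} [Fintype γ] [DecidableEq γ] (P : PMF γ) (f : γ → ℝ)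
    (hf : ∀ a, P a ≠ 0 → 0 < f a) {δ : ℝ} (hδ : 0 ≤ δ) (n : ℕ) :
    ∑ x : Fin n → γ, (typicalSet P δ n).indicator (fun x => seqProb P x * ∏ j, f (x j)) x ≤
      (2 : ℝ) ^ (n * typicalExponent P f δ) := by
  have h0 : (0 : ℝ) ≤ (2 : ℝ) ^ (n * typicalExponent P f δ) := Real.rpow_nonneg two_pos.le _
  calc _ ≤ ∑ x : Fin n → γ, seqProb P x * (2 : ℝ) ^ (n * typicalExponent P f δ) := by
        refine Finset.sum_le_sum fun x _ => ?_
        by_cases hx : x ∈ typicalSet P δ n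
        · rw [Set.indicator_of_mem hx]
          exact mul_le_mul_of_nonneg_left (prod_le_of_mem_typicalSet P f hf hδ hx)
            (seqProb_nonneg P x)
        · rw [Set.indicator_of_notMem hx]
          exact mul_nonneg (seqProb_nonneg P x) h0
    _ = _ := by rw [← Finset.sum_mul, sum_seqProb, one_mul]

/-- The collision probability of i.i.d. typical sequences under a letterwise map. -/
theorem collision_seqProb_le {γ F : Type*} [Fintype γ] [DecidableEq γ] (P : PMF γ) (π : γ → F)
    {δ : ℝ} (hδ : 0 ≤ δ) (n : ℕ) :
    collision (fun (y : Fin n → γ) j => π (y j)) ((typicalSet P δ n).indicator (seqProb P)) ≤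
      (2 : ℝ) ^ (n * typicalExponent P (classSum π fun a => (P a).toReal) δ) := by
  refine (collision_indicator_prod_le π (fun _ a => (P a).toReal)
    (fun _ _ => ENNReal.toReal_nonneg) _).trans ?_
  simp_rw [Finset.prod_mul_distrib]
  exact sum_indicator_mul_prod_le P _ (fun a ha => (toReal_pos P ha).trans_le
    (le_classSum π (fun _ => ENNReal.toReal_nonneg) a)) hδ n

theorem map_fst_apply {α β : Type*} [Fintype α] [Fintype β] (P : PMF (α × β)) (a : α) :
    (P.map Prod.fst a).toReal = ∑ b, (P (a, b)).toReal := by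
  classical
  rw [PMF.map_apply, tsum_fintype, Fintype.sum_prod_type, Finset.sum_eq_single a]
  · simp [ENNReal.toReal_sum, P.apply_ne_top]
  · intro a' _ h
    simp [h.symm]
  · simp

/-- The conditional probability `P(b | a)`; it is zero when `a` has probability zero. -/
noncomputable def condProb {α β : Type*} (P : PMF (α × β)) (z : α × β) : ℝ :=
  (P z).toReal / (P.map Prod.fst z.1).toReal

theorem condProb_nonneg {α β : Type*} (P : PMF (α × β)) (z : α × β) : 0 ≤ condProb P z :=
  div_nonneg ENNReal.toReal_nonneg ENNReal.toReal_nonneg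

section CondProb

variable {α β : Type*} [Fintype α] [Fintype β] (P : PMF (α × β))

theorem toReal_le_map_fst (z : α × β) : (P z).toReal ≤ (P.map Prod.fst z.1).toReal := by
  rw [map_fst_apply]
  exact Finset.single_le_sum (f := fun b => (P (z.1, b)).toReal)
    (fun _ _ => ENNReal.toReal_nonneg) (Finset.mem_univ z.2)

theorem condProb_pos {z : α × β} (hz : P z ≠ 0) : 0 < condProb P z :=
  div_pos (toReal_pos P hz) ((toReal_pos P hz).trans_le (toReal_le_map_fst P z))

theorem map_fst_mul_condProb (z : α × β) :
    (P.map Prod.fst z.1).toReal * condProb P z = (P z).toReal := by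
  by_cases h : (P.map Prod.fst z.1).toReal = 0
  · rw [h, zero_mul]
    exact (le_antisymm ((toReal_le_map_fst P z).trans h.le) ENNReal.toReal_nonneg).symm
  · rw [condProb, mul_div_cancel₀ _ h]

theorem sum_condProb_le_one (a : α) : ∑ b, condProb P (a, b) ≤ 1 := by
  simp only [condProb]
  rw [← Finset.sum_div, ← map_fst_apply]
  exact div_self_le_one _

theorem seqProb_map_fst_mul {n : ℕ} (x : Fin n → α) (y : Fin n → β) :
    seqProb (P.map Prod.fst) x * ∏ j, condProb P (x j, y j) =
      seqProb P fun j => (x j, y j) := by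
  rw [seqProb, ← Finset.prod_mul_distrib]
  exact Finset.prod_congr rfl fun j _ => map_fst_mul_condProb P (x j, y j)

theorem sum_sum_arrow_prod {n : ℕ} (g : (Fin n → α × β) → ℝ) :
    ∑ x : Fin n → α, ∑ y : Fin n → β, g (fun j => (x j, y j)) = ∑ z, g z := by
  rw [← Fintype.sum_prod_type', ← Equiv.sum_comp (Equiv.arrowProdEquivProdArrow (Fin n)
    (fun _ => α) (fun _ => β)).symm g]
  rfl

/-- For a source sequence `x`, the conditional probability of the sequence `y` given `x`, set to
zero unless `(x, y)` is jointly typical. -/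
noncomputable def typicalCondProb [DecidableEq α] [DecidableEq β] (δ : ℝ) {n : ℕ}
    (x : Fin n → α) : (Fin n → β) → ℝ :=
  Set.indicator {y | (fun j => (x j, y j)) ∈ typicalSet P δ n} fun y => ∏ j, condProb P (x j, y j)

variable [DecidableEq α] [DecidableEq β]

theorem typicalCondProb_nonneg (δ : ℝ) {n : ℕ} (x : Fin n → α) (y : Fin n → β) :
    0 ≤ typicalCondProb P δ x y :=
  Set.indicator_nonneg (fun _ _ => Finset.prod_nonneg fun _ _ => condProb_nonneg P _) y

theorem sum_typicalCondProb_le_one (δ : ℝ) {n : ℕ} (x : Fin n → α) :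
    ∑ y, typicalCondProb P δ x y ≤ 1 := by
  calc ∑ y, typicalCondProb P δ x y ≤ ∑ y : Fin n → β, ∏ j, condProb P (x j, y j) :=
        Finset.sum_le_sum fun y _ => Set.indicator_le_self'
          (fun _ _ => Finset.prod_nonneg fun _ _ => condProb_nonneg P _) y
    _ = ∏ j, ∑ b, condProb P (x j, b) := sum_prod_apply fun j b => condProb P (x j, b)
    _ ≤ 1 := Finset.prod_le_one
        (fun j _ => Finset.sum_nonneg fun b _ => condProb_nonneg P _)
        (fun j _ => sum_condProb_le_one P _)

theorem sum_seqProb_mul_typicalCondProb (δ : ℝ) (n : ℕ) :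
    ∑ x : Fin n → α, seqProb (P.map Prod.fst) x * ∑ y, typicalCondProb P δ x y =
      typicalProb P δ n := by
  classical
  rw [typicalProb, ← sum_sum_arrow_prod]
  refine Finset.sum_congr rfl fun x _ => ?_
  rw [Finset.mul_sum]
  refine Finset.sum_congr rfl fun y _ => ?_
  rw [typicalCondProb, Set.indicator_apply, Set.indicator_apply, mul_ite, mul_zero,
    seqProb_map_fst_mul]
  rfl

/-- The expected collision probability, under a letterwise map, of two sequences drawn from the
conditional law given the source sequence and kept when jointly typical with it. -/
theorem sum_seqProb_mul_collision_le {F : Type*} (π : β → F) {δ : ℝ} (hδ : 0 ≤ δ) (n : ℕ) :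
    ∑ x : Fin n → α, seqProb (P.map Prod.fst) x *
      collision (fun (y : Fin n → β) j => π (y j)) (typicalCondProb P δ x) ≤
      (2 : ℝ) ^ (n * typicalExponent P
        (fun z => classSum π (fun b => condProb P (z.1, b)) z.2) δ) := by
  classical
  refine le_trans (Finset.sum_le_sum fun x _ => mul_le_mul_of_nonneg_left
    (collision_indicator_prod_le π (fun j b => condProb P (x j, b))
      (fun _ _ => condProb_nonneg P _) _) (seqProb_nonneg _ x)) ?_
  refine le_trans (le_of_eq ?_) (sum_indicator_mul_prod_le P _ (fun z hz =>
    (condProb_pos P hz).trans_le (le_classSum π (fun b => condProb_nonneg P (z.1, b)) z.2)) hδ n)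
  rw [← sum_sum_arrow_prod]
  refine Finset.sum_congr rfl fun x _ => ?_
  rw [Finset.mul_sum]
  refine Finset.sum_congr rfl fun y _ => ?_
  rw [Set.indicator_apply, Set.indicator_apply, mul_ite, mul_zero, Finset.prod_mul_distrib,
    ← mul_assoc, seqProb_map_fst_mul]
  rfl

end CondProb

/-- The probability of the information sequences `u` when they are independent and i.i.d., set to
zero unless all of them are typical. -/
noncomputable def infoWeight {γ : Type*} [Fintype γ] [DecidableEq γ] {m : ℕ} (U : Fin m → PMF γ)
    (δ : ℝ) (k : Fin m → ℕ) (u : (i : Fin m) → Fin (k i) → γ) : ℝ :=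
  ∏ i, (typicalSet (U i) δ (k i)).indicator (seqProb (U i)) (u i)

section InfoWeight

variable {γ : Type*} [Fintype γ] [DecidableEq γ] {m : ℕ} (U : Fin m → PMF γ) (δ : ℝ)
  (k : Fin m → ℕ)

theorem infoWeight_nonneg (u : (i : Fin m) → Fin (k i) → γ) : 0 ≤ infoWeight U δ k u :=
  Finset.prod_nonneg fun _ _ => Set.indicator_nonneg (fun _ _ => seqProb_nonneg _ _) _

theorem sum_infoWeight : ∑ u, infoWeight U δ k u = ∏ i, typicalProb (U i) δ (k i) := by
  classical
  simp only [infoWeight, typicalProb]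
  rw [Finset.prod_univ_sum, Fintype.piFinset_univ]

theorem mem_typicalSet_of_infoWeight_ne_zero {u : (i : Fin m) → Fin (k i) → γ}
    (hu : infoWeight U δ k u ≠ 0) (i : Fin m) : u i ∈ typicalSet (U i) δ (k i) := by
  by_contra h
  exact hu (Finset.prod_eq_zero (Finset.mem_univ i) (Set.indicator_of_notMem h _))

end InfoWeight

theorem collision_infoWeight_le {p r s m : ℕ} [Fact p.Prime] (U : Fin m → PMF (ZMod (p ^ r)))
    {δ : ℝ} (hδ : 0 ≤ δ) (k : Fin m → ℕ) :
    collision (infoResidue p r s k) (infoWeight U δ k) ≤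
      ∏ i, (2 : ℝ) ^ (k i * typicalExponent (U i)
        (classSum (residue p r s) fun a => (U i a).toReal) δ) := by
  refine (collision_pi (fun i => vecResidue p r s (k i))
    fun i => (typicalSet (U i) δ (k i)).indicator (seqProb (U i))).trans_le ?_
  refine Finset.prod_le_prod (fun i _ => collision_nonneg _ fun _ =>
    Set.indicator_nonneg (fun _ _ => seqProb_nonneg _ _) _) fun i _ => ?_
  exact collision_seqProb_le (U i) (residue p r s) hδ (k i)

/-! ### The covering probability for a fixed block length -/

theorem indep_apply {α β : Type*} (P : PMF α) (P' : PMF β) (a : α) (b : β) :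
    indep P P' (a, b) = P a * P' b := by
  classical
  rw [indep, PMF.bind_apply, tsum_eq_single a, PMF.map_apply, tsum_eq_single b]
  · simp
  · intro b' hb
    simp [hb.symm]
  · intro a' ha
    simp [PMF.map_apply, ha.symm]

theorem experiment_toReal {N : ℕ} [NeZero N] {m : ℕ} {α : Type*} [Fintype α] (PX : PMF α)
    (n l : ℕ) (k : Fin m → ℕ) (c : Params N n l k) (x : Fin n → α) :
    (experiment N PX n l k (c, x)).toReal =
      (Fintype.card (Params N n l k) : ℝ)⁻¹ * seqProb PX x := by
  rw [experiment, indep_apply, ENNReal.toReal_mul, iid_toReal, PMF.uniformOfFintype_apply]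
  simp

/-- The probability that no codeword is jointly typical with the source sequence. If none is, then
the weight `Z` of the outer code vanishes, while its mean given the source is some `F ∈ [0, 1]`;
then `1 ≤ 2 (1 - F)² + 2 F² ≤ 2 (1 - F) + 2 (Z - F)²`, and the expectations of the two terms are
controlled by typicality and by the variance. -/
theorem one_sub_coveringProb_le {p r : ℕ} [Fact p.Prime] {α : Type*} [Fintype α] [DecidableEq α]
    (P : PMF (α × ZMod (p ^ r))) {m : ℕ} (U : Fin m → PMF (ZMod (p ^ r))) {δ ε : ℝ} (hδ : 0 ≤ δ)
    (hδε : δ ≤ ε) (n l : ℕ) (hl : 0 < l) (k : Fin m → ℕ)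
    (hA : 0 < ∏ i, typicalProb (U i) δ (k i)) :
    1 - (coveringProb P U ε n l k).toReal ≤ 2 * (1 - typicalProb P δ n) +
      2 * ((∏ i, typicalProb (U i) δ (k i))⁻¹ ^ 2 * ∑ s ∈ Finset.Icc 1 r, ((p : ℝ) ^ s) ^ n / l *
        (∏ i, (2 : ℝ) ^ (k i * typicalExponent (U i)
          (classSum (residue p r s) fun a => (U i a).toReal) δ)) *
        (2 : ℝ) ^ (n * typicalExponent P
          (fun z => classSum (residue p r s) (fun b => condProb P (z.1, b)) z.2) δ)) := by
  classical
  set S : Set (Params (p ^ r) n l k × (Fin n → α)) :=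
    {ω | ∃ y ∈ outerCode ε U ω.1, (fun j => (ω.2 j, y j)) ∈ typicalSet P ε n} with hS
  set M : ℝ := (Fintype.card (Params (p ^ r) n l k) : ℝ) with hM
  have hM0 : 0 < M := Nat.cast_pos.2 Fintype.card_pos
  set A := ∏ i, typicalProb (U i) δ (k i)
  set PX := P.map Prod.fst
  set w : ((i : Fin m) → Fin (k i) → ZMod (p ^ r)) → ℝ := fun u => A⁻¹ * infoWeight U δ k u
    with hwdef
  have hw : ∀ u, 0 ≤ w u := fun u =>
    mul_nonneg (inv_nonneg.2 hA.le) (infoWeight_nonneg U δ k u)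
  have hw1 : ∑ u, w u = 1 := by
    rw [← Finset.mul_sum, sum_infoWeight, inv_mul_cancel₀ hA.ne']
  set F : (Fin n → α) → ℝ := fun x => ∑ y, typicalCondProb P δ x y
  have hF0 : ∀ x, 0 ≤ F x := fun x => Finset.sum_nonneg fun y _ => typicalCondProb_nonneg P δ x y
  have hF1 : ∀ x, F x ≤ 1 := fun x => sum_typicalCondProb_le_one P δ x
  have hzero : ∀ c x, (c, x) ∉ S → codeWeight w (typicalCondProb P δ x) c = 0 := by
    intro c x hcx
    refine Finset.sum_eq_zero fun z _ => ?_
    by_contra hne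
    refine hcx ⟨codeword z.1 z.2 c, ?_, ?_⟩
    · have hu : infoWeight U δ k z.1 ≠ 0 := fun h => hne (by simp [hwdef, h])
      refine Set.mem_iUnion.2 ⟨z.2, _, ⟨z.1, fun i => typicalSet_mono _ hδε _
        (mem_typicalSet_of_infoWeight_ne_zero U δ k hu i), rfl⟩, rfl⟩
    · refine typicalSet_mono _ hδε _ ?_
      by_contra h
      refine hne ?_
      rw [typicalCondProb, Set.indicator_of_notMem (by exact h), mul_zero, mul_zero]
  have hcov : (coveringProb P U ε n l k).toReal =
      ∑ c, ∑ x, if (c, x) ∈ S then M⁻¹ * seqProb PX x else 0 := by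
    rw [coveringProb, PMF.toOuterMeasure_apply_fintype, ENNReal.toReal_sum, Fintype.sum_prod_type]
    · refine Finset.sum_congr rfl fun c _ => Finset.sum_congr rfl fun x _ => ?_
      rw [Set.indicator_apply, apply_ite ENNReal.toReal, experiment_toReal]
      rfl
    · intro a _
      refine ne_top_of_le_ne_top (PMF.apply_ne_top _ a) (Set.indicator_le_self _ _ a)
  have hone : (1 : ℝ) = ∑ c : Params (p ^ r) n l k, ∑ x : Fin n → α,
      M⁻¹ * seqProb PX x := by
    simp_rw [← Finset.mul_sum, sum_seqProb]
    simp only [Finset.sum_const, Finset.card_univ, nsmul_eq_mul, mul_one]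
    rw [← hM, inv_mul_cancel₀ hM0.ne']
  have hvar : ∀ x, ∑ c : Params (p ^ r) n l k,
      (codeWeight w (typicalCondProb P δ x) c - F x) ^ 2 ≤ M * ∑ s ∈ Finset.Icc 1 r,
        ((p : ℝ) ^ s) ^ n / l * collision (infoResidue p r s k) w *
          collision (vecResidue p r s n) (typicalCondProb P δ x) := fun x =>
    sum_sq_codeWeight_sub_le hl hw hw1 (typicalCondProb_nonneg P δ x)
  calc 1 - (coveringProb P U ε n l k).toReal
      = ∑ c : Params (p ^ r) n l k, ∑ x, (M⁻¹ * seqProb PX x) *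
          (if (c, x) ∈ S then 0 else 1) := by
        rw [hcov]
        conv_lhs => rw [hone]
        rw [← Finset.sum_sub_distrib]
        refine Finset.sum_congr rfl fun c _ => ?_
        rw [← Finset.sum_sub_distrib]
        refine Finset.sum_congr rfl fun x _ => ?_
        split_ifs <;> simp
    _ ≤ ∑ c : Params (p ^ r) n l k, ∑ x, (M⁻¹ * seqProb PX x) *
          (2 * (1 - F x) + 2 * (codeWeight w (typicalCondProb P δ x) c - F x) ^ 2) := by
        refine Finset.sum_le_sum fun c _ => Finset.sum_le_sum fun x _ =>
          mul_le_mul_of_nonneg_left ?_ (mul_nonneg (inv_nonneg.2 hM0.le) (seqProb_nonneg _ x))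
        have h0 := hF0 x
        have h1 := hF1 x
        split_ifs with h
        · nlinarith [sq_nonneg (codeWeight w (typicalCondProb P δ x) c - F x)]
        · rw [hzero c x h]
          nlinarith [sq_nonneg (2 * F x - 1)]
    _ = ∑ x, seqProb PX x * (2 * (1 - F x) + 2 * (M⁻¹ * ∑ c : Params (p ^ r) n l k,
          (codeWeight w (typicalCondProb P δ x) c - F x) ^ 2)) := by
        rw [Finset.sum_comm]
        refine Finset.sum_congr rfl fun x _ => ?_
        rw [← Finset.mul_sum, Finset.sum_add_distrib, ← Finset.mul_sum]
        simp only [Finset.sum_const, Finset.card_univ, nsmul_eq_mul]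
        rw [← hM]
        field_simp
        rw [← Finset.mul_sum]
        ring
    _ ≤ ∑ x, seqProb PX x * (2 * (1 - F x) + 2 * ∑ s ∈ Finset.Icc 1 r,
          ((p : ℝ) ^ s) ^ n / l * collision (infoResidue p r s k) w *
          collision (vecResidue p r s n) (typicalCondProb P δ x)) := by
        refine Finset.sum_le_sum fun x _ => mul_le_mul_of_nonneg_left ?_ (seqProb_nonneg _ x)
        gcongr
        rw [inv_mul_le_iff₀ hM0]
        exact hvar x
    _ = 2 * (1 - typicalProb P δ n) + 2 * ∑ s ∈ Finset.Icc 1 r,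
          ((p : ℝ) ^ s) ^ n / l * collision (infoResidue p r s k) w *
          ∑ x, seqProb PX x * collision (vecResidue p r s n) (typicalCondProb P δ x) := by
        simp_rw [mul_add, Finset.sum_add_distrib]
        congr 1
        · rw [show 1 - typicalProb P δ n = ∑ x : Fin n → α, seqProb PX x - ∑ x, seqProb PX x * F x by
              rw [sum_seqProb, sum_seqProb_mul_typicalCondProb], ← Finset.sum_sub_distrib,
            Finset.mul_sum]
          exact Finset.sum_congr rfl fun x _ => by ring
        · simp_rw [Finset.mul_sum]
          rw [Finset.sum_comm]
          exact Finset.sum_congr rfl fun s _ => Finset.sum_congr rfl fun x _ => by ring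
    _ ≤ _ := by
        rw [Finset.mul_sum (Finset.Icc 1 r) _ (A⁻¹ ^ 2)]
        gcongr 2 * (1 - typicalProb P δ n) + 2 * ?_
        refine Finset.sum_le_sum fun s _ => ?_
        have h1 := collision_infoWeight_le (s := s) U hδ k
        have h2 := sum_seqProb_mul_collision_le P (residue p r s) hδ n
        have h3 : 0 ≤ ∑ x, seqProb PX x *
            collision (vecResidue p r s n) (typicalCondProb P δ x) :=
          Finset.sum_nonneg fun x _ => mul_nonneg (seqProb_nonneg _ x)
            (collision_nonneg _ (typicalCondProb_nonneg P δ x))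
        rw [hwdef, collision_const_mul]
        calc _ = A⁻¹ ^ 2 * (((p : ℝ) ^ s) ^ n / l *
              collision (infoResidue p r s k) (infoWeight U δ k) *
              ∑ x, seqProb PX x * collision (vecResidue p r s n) (typicalCondProb P δ x)) := by
              ring
          _ ≤ _ := by
              gcongr
              exact h2

/-! ### Entropies -/

theorem map_apply_eq_classSum {γ F : Type*} [Fintype γ] (P : PMF γ) (π : γ → F) (a : γ) :
    (P.map π (π a)).toReal = classSum π (fun b => (P b).toReal) a := by
  classical
  rw [PMF.map_apply, tsum_fintype, ENNReal.toReal_sum]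
  · exact Finset.sum_congr rfl fun b _ => by split_ifs <;> rfl
  · intro b _
    split_ifs
    exacts [P.apply_ne_top b, ENNReal.zero_ne_top]

theorem sum_map_toReal_mul {γ F : Type*} [Fintype γ] [Fintype F] (P : PMF γ) (π : γ → F)
    (g : F → ℝ) : ∑ c, (P.map π c).toReal * g c = ∑ a, (P a).toReal * g (π a) := by
  classical
  have h : ∀ c, (P.map π c).toReal = ∑ a, if c = π a then (P a).toReal else 0 := by
    intro c
    rw [PMF.map_apply, tsum_fintype, ENNReal.toReal_sum]
    · exact Finset.sum_congr rfl fun b _ => by split_ifs <;> rfl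
    · intro b _
      split_ifs
      exacts [P.apply_ne_top b, ENNReal.zero_ne_top]
  simp_rw [h, Finset.sum_mul]
  rw [Finset.sum_comm]
  simp

theorem condEntropy_map {γ A B : Type*} [Fintype γ] [Fintype A] [Fintype B] (P : PMF γ)
    (f : γ → A × B) :
    condEntropy (P.map f) = -∑ z, (P z).toReal *
      Real.logb 2 ((P.map f (f z)).toReal / (P.map (fun z => (f z).2) (f z).2).toReal) := by
  rw [condEntropy, ← Fintype.sum_prod_type', sum_map_toReal_mul P f fun c =>
    Real.logb 2 ((P.map f (c.1, c.2)).toReal / ((P.map f).map Prod.snd c.2).toReal), PMF.map_comp]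
  rfl

theorem condEntropy_nonneg {A B : Type*} [Fintype A] [Fintype B] (P : PMF (A × B)) :
    0 ≤ condEntropy P := by
  rw [condEntropy, neg_nonneg]
  refine Finset.sum_nonpos fun a _ => Finset.sum_nonpos fun b _ =>
    mul_nonpos_of_nonneg_of_nonpos ENNReal.toReal_nonneg
      (Real.logb_nonpos one_lt_two (by positivity) (div_le_one_of_le₀ ?_ ENNReal.toReal_nonneg))
  have h := le_classSum (Prod.snd : A × B → B) (fun z => ENNReal.toReal_nonneg (a := P z)) (a, b)
  rwa [← map_apply_eq_classSum] at h

/-- The conditional entropy `H([X̂]_s | X)` as an expectation of conditional log-probabilities. -/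
theorem condEntropy_testResidue {p r s : ℕ} [Fact p.Prime] {α : Type*} [Fintype α]
    (P : PMF (α × ZMod (p ^ r))) :
    condEntropy (testResidue p r s P) = -∑ z, (P z).toReal *
      Real.logb 2 (classSum (residue p r s) (fun b => condProb P (z.1, b)) z.2) := by
  classical
  rw [testResidue, condEntropy_map]
  congr 1
  refine Finset.sum_congr rfl fun z _ => ?_
  congr 2
  rw [map_apply_eq_classSum]
  simp only [classSum, condProb]
  rw [Fintype.sum_prod_type, Finset.sum_eq_single z.1, Finset.sum_div]
  · refine Finset.sum_congr rfl fun b _ => ?_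
    simp only [Prod.mk.injEq, and_true, ite_div, zero_div]
    split_ifs <;> rfl
  · intro a _ ha
    simp [ha.symm]
  · simp

theorem mixture_apply {γ : Type*} {m : ℕ} (q : PMF (Fin m)) (U : Fin m → PMF γ) (a : γ)
    (i : Fin m) : mixture q U (a, i) = q i * U i a := by
  classical
  rw [mixture, PMF.bind_apply, tsum_eq_single i, PMF.map_apply, tsum_eq_single a]
  · simp
  · intro b hb
    simp [hb.symm]
  · intro j hj
    simp [PMF.map_apply, hj.symm]

theorem mixture_map_snd {γ : Type*} {m : ℕ} (q : PMF (Fin m)) (U : Fin m → PMF γ) :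
    (mixture q U).map (fun z => z.2) = q := by
  rw [mixture, PMF.map_bind]
  have h : ∀ i, ((U i).map fun a => (a, i)).map (fun z => z.2) = PMF.pure i := fun i =>
    (PMF.map_comp _ (U i) _).trans (PMF.map_const (U i) i)
  simp_rw [h, PMF.bind_pure]

/-- The conditional entropy `H([U]_s | Q)` of the mixture, as an average over the values of `Q`. -/
theorem condEntropy_mixtureResidue {p r s m : ℕ} [Fact p.Prime] (q : PMF (Fin m))
    (hq : ∀ i, q i ≠ 0) (U : Fin m → PMF (ZMod (p ^ r))) :
    condEntropy (mixtureResidue p r s q U) = -∑ i, (q i).toReal * ∑ a, (U i a).toReal *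
      Real.logb 2 (classSum (residue p r s) (fun b => (U i b).toReal) a) := by
  classical
  rw [mixtureResidue, condEntropy_map, Fintype.sum_prod_type, Finset.sum_comm]
  congr 1
  refine Finset.sum_congr rfl fun i _ => ?_
  rw [Finset.mul_sum]
  refine Finset.sum_congr rfl fun a _ => ?_
  rw [mixture_apply, ENNReal.toReal_mul, mul_assoc]
  congr 3
  rw [map_apply_eq_classSum, mixture_map_snd, div_eq_iff (toReal_pos q (hq i)).ne']
  simp only [classSum]
  rw [Fintype.sum_prod_type, Finset.sum_mul]
  refine Finset.sum_congr rfl fun b _ => ?_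
  rw [Finset.sum_eq_single i]
  · simp [mixture_apply, mul_comm]
  · intro j _ hj
    simp [hj.symm]
  · simp

/-! ### The limit of the covering probability -/

theorem tendsto_typicalExponent_zero {γ : Type*} [Fintype γ] (P : PMF γ) (f : γ → ℝ) :
    Tendsto (typicalExponent P f) (𝓝[>] 0) (𝓝 (∑ a, (P a).toReal * Real.logb 2 (f a))) := by
  have h : Continuous (typicalExponent P f) := by
    unfold typicalExponent
    fun_prop
  simpa [typicalExponent] using (h.tendsto 0).mono_left nhdsWithin_le_nhds

/-- If the exponents `e n` have a negative limit, then `2 ^ (n * e n)` tends to zero. -/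
theorem tendsto_two_rpow_mul_zero {e : ℕ → ℝ} {L : ℝ} (he : Tendsto e atTop (𝓝 L)) (hL : L < 0) :
    Tendsto (fun n : ℕ => (2 : ℝ) ^ ((n : ℝ) * e n)) atTop (𝓝 0) :=
  (tendsto_rpow_atBot_of_base_gt_one 2 one_lt_two).comp
    (tendsto_natCast_atTop_atTop.atTop_mul_neg hL he)

/-- The covering probability tends to one when, for each `s`, the limiting exponent of the
contribution of `s` to the variance is negative. Here `κ i` is the limit of `k i / n`. -/
theorem tendsto_coveringProb {p r : ℕ} [Fact p.Prime] {α : Type*} [Fintype α] [DecidableEq α]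
    (P : PMF (α × ZMod (p ^ r))) {m : ℕ} (U : Fin m → PMF (ZMod (p ^ r)))
    {κ : Fin m → ℝ} (hκ : ∀ i, 0 < κ i) {k : ℕ → Fin m → ℕ}
    (hk : ∀ i, Tendsto (fun n => (k n i : ℝ) / n) atTop (𝓝 (κ i)))
    {l : ℕ → ℕ} (hl : ∀ n, 0 < l n) {Rbin : ℝ}
    (hRbin : Tendsto (fun n => Real.logb 2 (l n) / n) atTop (𝓝 Rbin))
    (hcov : ∀ s ∈ Finset.Icc 1 r, Real.logb 2 ((p : ℝ) ^ s) - Rbin +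
      ∑ i, κ i * (∑ a, (U i a).toReal *
        Real.logb 2 (classSum (residue p r s) (fun b => (U i b).toReal) a)) +
      ∑ z, (P z).toReal *
        Real.logb 2 (classSum (residue p r s) (fun b => condProb P (z.1, b)) z.2) < 0)
    {ε : ℝ} (hε : 0 < ε) :
    Tendsto (fun n => coveringProb P U ε n (l n) (k n)) atTop (𝓝 1) := by
  -- A typicality parameter small enough to preserve the strict inequalities.
  obtain ⟨δ, hδ0, hδε, hδ⟩ : ∃ δ, 0 < δ ∧ δ ≤ ε ∧ ∀ s ∈ Finset.Icc 1 r,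
      Real.logb 2 ((p : ℝ) ^ s) - Rbin +
        ∑ i, κ i * typicalExponent (U i)
          (classSum (residue p r s) fun b => (U i b).toReal) δ +
        typicalExponent P
          (fun z => classSum (residue p r s) (fun b => condProb P (z.1, b)) z.2) δ < 0 := by
    have h1 : ∀ᶠ δ : ℝ in 𝓝[>] 0, ∀ s ∈ Finset.Icc 1 r,
      Real.logb 2 ((p : ℝ) ^ s) - Rbin +
        ∑ i, κ i * typicalExponent (U i)
          (classSum (residue p r s) fun b => (U i b).toReal) δ +
        typicalExponent P
          (fun z => classSum (residue p r s) (fun b => condProb P (z.1, b)) z.2) δ < 0 := by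
      rw [Filter.eventually_all_finset]
      intro s hs
      refine Tendsto.eventually_lt_const (hcov s hs) (Tendsto.add (Tendsto.add tendsto_const_nhds
        (tendsto_finsetSum _ fun i _ => ?_)) (tendsto_typicalExponent_zero P _))
      exact (tendsto_typicalExponent_zero (U i) _).const_mul _
    have h2 : ∀ᶠ δ : ℝ in 𝓝[>] 0, δ ∈ Set.Ioc 0 ε := Ioc_mem_nhdsGT hε
    obtain ⟨δ, h, h'⟩ := (h1.and h2).exists
    exact ⟨δ, h'.1, h'.2, h⟩
  have hkn : ∀ i, Tendsto (fun n => k n i) atTop atTop := by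
    intro i
    have h : Tendsto (fun n : ℕ => (n : ℝ) * ((k n i : ℝ) / n)) atTop atTop :=
      tendsto_natCast_atTop_atTop.atTop_mul_pos (hκ i) (hk i)
    rw [← tendsto_natCast_atTop_iff (R := ℝ)]
    refine h.congr' ?_
    filter_upwards [eventually_gt_atTop 0] with n hn
    field_simp
  have hA : Tendsto (fun n => ∏ i, typicalProb (U i) δ (k n i)) atTop (𝓝 1) := by
    simpa using tendsto_finsetProd Finset.univ
      fun i _ => (tendsto_typicalProb (U i) hδ0).comp (hkn i)
  have hterm : ∀ s ∈ Finset.Icc 1 r, Tendsto (fun n => ((p : ℝ) ^ s) ^ n / l n *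
        (∏ i, (2 : ℝ) ^ (k n i * typicalExponent (U i)
          (classSum (residue p r s) fun a => (U i a).toReal) δ)) *
        (2 : ℝ) ^ (n * typicalExponent P
          (fun z => classSum (residue p r s) (fun b => condProb P (z.1, b)) z.2) δ))
        atTop (𝓝 0) := by
    intro s hs
    have hexp : Tendsto (fun n : ℕ => Real.logb 2 ((p : ℝ) ^ s) - Real.logb 2 (l n) / n +
        ∑ i, (k n i : ℝ) / n * typicalExponent (U i)
          (classSum (residue p r s) fun b => (U i b).toReal) δ +
        typicalExponent P
          (fun z => classSum (residue p r s) (fun b => condProb P (z.1, b)) z.2) δ) atTop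
        (𝓝 (Real.logb 2 ((p : ℝ) ^ s) - Rbin +
        ∑ i, κ i * typicalExponent (U i)
          (classSum (residue p r s) fun b => (U i b).toReal) δ +
        typicalExponent P
          (fun z => classSum (residue p r s) (fun b => condProb P (z.1, b)) z.2) δ)) :=
      ((hRbin.const_sub _).add (tendsto_finsetSum _ fun i _ => (hk i).mul_const _)).add_const _
    refine (tendsto_two_rpow_mul_zero hexp (hδ s hs)).congr' ?_
    filter_upwards [eventually_gt_atTop 0] with n hn
    have hn' : (n : ℝ) ≠ 0 := by exact_mod_cast hn.ne'
    have hp : (0 : ℝ) < (p : ℝ) ^ s := pow_pos (by exact_mod_cast (Fact.out : p.Prime).pos) s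
    have hln : (0 : ℝ) < l n := by exact_mod_cast hl n
    -- All factors are powers of two; their exponents add up to `n` times the sequence in `hexp`.
    have e1 : ((p : ℝ) ^ s) ^ n = (2 : ℝ) ^ (n * Real.logb 2 ((p : ℝ) ^ s)) := by
      rw [mul_comm, Real.rpow_mul two_pos.le, Real.rpow_logb two_pos (by norm_num) hp,
        Real.rpow_natCast]
    have e2 : (l n : ℝ) = (2 : ℝ) ^ (Real.logb 2 (l n)) :=
      (Real.rpow_logb two_pos (by norm_num) hln).symm
    rw [e1, ← Real.rpow_sum_of_pos two_pos]
    conv_rhs => rw [e2]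
    rw [← Real.rpow_sub two_pos, ← Real.rpow_add two_pos, ← Real.rpow_add two_pos]
    congr 1
    rw [mul_add, mul_add, mul_sub, Finset.mul_sum]
    congr 2
    · field_simp
    · exact Finset.sum_congr rfl fun i _ => by field_simp
  have hbound : Tendsto (fun n => 2 * (1 - typicalProb P δ n) +
      2 * ((∏ i, typicalProb (U i) δ (k n i))⁻¹ ^ 2 *
        ∑ s ∈ Finset.Icc 1 r, ((p : ℝ) ^ s) ^ n / l n *
        (∏ i, (2 : ℝ) ^ (k n i * typicalExponent (U i)
          (classSum (residue p r s) fun a => (U i a).toReal) δ)) *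
        (2 : ℝ) ^ (n * typicalExponent P
          (fun z => classSum (residue p r s) (fun b => condProb P (z.1, b)) z.2) δ)))
      atTop (𝓝 0) := by
    simpa using (((tendsto_typicalProb P hδ0).const_sub 1).const_mul 2).add
      ((((hA.inv₀ one_ne_zero).pow 2).mul (tendsto_finsetSum _ hterm)).const_mul 2)
  have hle : ∀ n, coveringProb P U ε n (l n) (k n) ≤ 1 := fun n =>
    (PMF.toOuterMeasure_apply _ _).le.trans ((ENNReal.tsum_le_tsum fun _ =>
      Set.indicator_le_self' (fun _ _ => zero_le) _).trans (PMF.tsum_coe _).le)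
  have hreal : Tendsto (fun n => (coveringProb P U ε n (l n) (k n)).toReal) atTop (𝓝 1) := by
    have h : Tendsto _ atTop (𝓝 (1 - 0 : ℝ)) := hbound.const_sub 1
    rw [sub_zero] at h
    refine tendsto_of_tendsto_of_tendsto_of_le_of_le' h tendsto_const_nhds ?_
      (Eventually.of_forall fun n => ENNReal.toReal_le_of_le_ofReal zero_le_one
        (by simpa using hle n))
    filter_upwards [hA.eventually_const_lt one_pos] with n hn
    have := one_sub_coveringProb_le P U hδ0.le hδε n (l n) (hl n) (k n) hn
    linarith
  refine ((ENNReal.tendsto_toReal_iff (fun n => ?_) ENNReal.one_ne_top).1 (by simpa using hreal))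
  exact ne_top_of_le_ne_top ENNReal.one_ne_top (hle n)

end QGC

theorem lemma3 (p r : ℕ) [Fact p.Prime] {α : Type*} [Fintype α] [DecidableEq α]
    (P : PMF (α × ZMod (p ^ r)))
    (hP : P.map Prod.snd = PMF.uniformOfFintype (ZMod (p ^ r)))
    (m : ℕ) (U : Fin m → PMF (ZMod (p ^ r)))
    (q : PMF (Fin m)) (hq : ∀ i, q i ≠ 0)
    (ρ : ℝ) (hρ : 0 < ρ)
    (k : ℕ → Fin m → ℕ)
    (hk : ∀ i, Tendsto (fun n => (k n i : ℝ) / n) atTop (𝓝 (ρ * (q i).toReal)))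
    (l : ℕ → ℕ) (hl : ∀ n, 0 < l n)
    (Rbin : ℝ) (hRbin : Tendsto (fun n => Real.logb 2 (l n) / n) atTop (𝓝 Rbin))
    (R : ℝ) (hR : R = ρ * QGC.condEntropy (QGC.mixture q U))
    (hcov : ∀ s : ℕ, 1 ≤ s → s ≤ r →
      Rbin + QGC.condEntropy (QGC.mixtureResidue p r s q U) /
          QGC.condEntropy (QGC.mixture q U) * R
        > Real.logb 2 ((p : ℝ) ^ s) - QGC.condEntropy (QGC.testResidue p r s P))
    (ε : ℝ) (hε : 0 < ε) :
    Tendsto (fun n => QGC.coveringProb P U ε n (l n) (k n)) atTop (𝓝 1) := by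
  refine QGC.tendsto_coveringProb P U (fun i => mul_pos hρ (QGC.toReal_pos q (hq i))) hk hl hRbin
    (fun s hs => ?_) hε
  obtain ⟨hs1, hsr⟩ := Finset.mem_Icc.1 hs
  have h := hcov s hs1 hsr
  -- If `H(U | Q) = 0`, the quotient is zero in Lean, and `H([U]_s | Q) ≥ 0` suffices.
  have hrate : QGC.condEntropy (QGC.mixtureResidue p r s q U) /
      QGC.condEntropy (QGC.mixture q U) * R ≤
      ρ * QGC.condEntropy (QGC.mixtureResidue p r s q U) := by
    rw [hR]
    by_cases h0 : QGC.condEntropy (QGC.mixture q U) = 0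
    · rw [h0, div_zero, zero_mul]
      exact mul_nonneg hρ.le (QGC.condEntropy_nonneg _)
    · exact le_of_eq (by field_simp)
  rw [QGC.condEntropy_testResidue] at h
  rw [QGC.condEntropy_mixtureResidue q hq U] at h hrate
  simp_rw [mul_assoc, ← Finset.mul_sum]
  linarith
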